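/- Let $p,q\ge 1$ be integers. Let $\mathbb R^{p,q}$ be $\mathbb R^p\times\mathbb R^q$ with the metric $dx_1^2+\cdots+dx_p^2-dy_1^2-\cdots-dy_q^2$, let $\Xi=\{(x,y):|x|=|y|\}\setminus\{0\}$ be its light cone, $\nu(x,y)=|x|=|y|$ on $\Xi$, and $M=\{(x,y):|x|=|y|=1\}=S^{p-1}\times S^{q-1}\subset\Xi$ with the induced pseudo-Riemannian metric $g_M$. The group $O(p,q)=\{h\in GL(p+q,\mathbb R): {}^t h\,I_{p,q}\,h=I_{p,q}\}$, $I_{p,q}=\operatorname{diag}(1,\dots,1,-1,\dots,-1)$, acts linearly on $\Xi$, and on $M\simeq\Xi/\mathbb R_{>0}$ by $L_h z=\Phi(h\cdot z)$, where $\Phi(x,y)=(x/|x|,\,y/|y|)$. Put $$\widetilde\Delta_M=\Bigl(\Delta_{S^{p-1}}-\tfrac14(p-2)^2\Bigr)-\Bigl(\Delta_{S^{q-1}}-\tfrac14(q-2)^2\Bigr),\qquad V^{p,q}=\{f\in C^\infty(M,\mathbb C):\widetilde\Delta_M f=0\},$$ where $\Delta_{S^{n-1}}$ is the Laplace--Beltrami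 operator of the unit sphere. If $p+q\ge4$, i.e. if $n=\dim M=p+q-2\ge2$, then on $C^\infty(M,\mathbb C)$ the operator $\widetilde\Delta_M$ is the Yamabe operator $\Delta_M-\frac{n-2}{4(n-1)}K_M$ of $(M,g_M)$, where $\Delta_M$ is the Laplace--Beltrami operator and $K_M$ the scalar curvature of $g_M$ (normalized so that the unit sphere $S^m$ has scalar curvature $m(m-1)$). Moreover, for all $p,q\ge1$, the formula $$(\varpi^{p,q}(h^{-1})f)(z)=\nu(h\cdot z)^{-\frac{p+q-4}{2}}\,f(L_h z)\qquad(h\in O(p,q),\ f\in V^{p,q},\ z\in M)$$ defines a representation of $O(p,q)$ on $V^{p,q}$: each $\varpi^{p,q}(h)$ is a linear map of $V^{p,q}$ into itself, $\varpi^{p,q}(1)=\mathrm{id}$, and $\varpi^{p,q}(h_1h_2)=\varpi^{p,q}(h_1)\varpi^{p,q}(h_2)$. -/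

import Mathlib

open scoped Manifold ContDiff

noncomputable section

namespace PseudoRiemannian

/-! Pseudo-Riemannian geometry in local coordinates.  `I` is the model of the manifold `M`, with
model vector space `E`, and `b` is a basis of `E`, so that every chart of `M` provides coordinates
indexed by `ι`.  At a point `x` everything is computed in the chart centred at `x`. -/

variable {ι E H M : Type*}
  [NormedAddCommGroup E] [NormedSpace ℝ E] [TopologicalSpace H] (I : ModelWithCorners ℝ E H)
  [TopologicalSpace M] [ChartedSpace H M]

/-- A field of bilinear forms on the tangent spaces of `M`. -/
abbrev MetricField (M : Type*) [TopologicalSpace M] [ChartedSpace H M] : Type _ :=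
  (x : M) → TangentSpace I x → TangentSpace I x → ℝ

/-- The field of bilinear forms induced on `M` by a map `j : M → W` into a vector space that carries
the constant bilinear form `B`. -/
def inducedMetric {W : Type*} [NormedAddCommGroup W] [NormedSpace ℝ W]
    (j : M → W) (B : W → W → ℝ) : MetricField I M :=
  fun x v w => B (mfderiv I 𝓘(ℝ, W) j x v) (mfderiv I 𝓘(ℝ, W) j x w)

/-- The `i`-th partial derivative with respect to the basis `b`. -/
def partialDeriv {V : Type*} [NormedAddCommGroup V] [NormedSpace ℝ V]
    (b : Module.Basis ι ℝ E) (i : ι) (F : E → V) (u : E) : V :=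
  fderiv ℝ F u (b i)

/-- The components `g_{ij}` of the metric in the chart at `x`, as functions of the coordinates. -/
def metricMatrix (b : Module.Basis ι ℝ E) (g : MetricField I M) (x : M) (u : E) : Matrix ι ι ℝ :=
  Matrix.of fun i j => g ((extChartAt I x).symm u)
    (mfderiv 𝓘(ℝ, E) I (extChartAt I x).symm u (b i))
    (mfderiv 𝓘(ℝ, E) I (extChartAt I x).symm u (b j))

lemma contDiffAt_partialDeriv (b : Module.Basis ι ℝ E) (i : ι) {F : E → ℂ} {u : E}
    (hF : ContDiffAt ℝ ∞ F u) : ContDiffAt ℝ ∞ (partialDeriv b i F) u :=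
  (hF.fderiv_right (m := ∞) (by simp)).clm_apply contDiffAt_const

lemma partialDeriv_add (b : Module.Basis ι ℝ E) (i : ι) {F G : E → ℂ} {u : E}
    (hF : ContDiffAt ℝ ∞ F u) (hG : ContDiffAt ℝ ∞ G u) :
    partialDeriv b i (F + G) u = partialDeriv b i F u + partialDeriv b i G u := by
  simp only [partialDeriv]
  rw [fderiv_add (hF.differentiableAt (by simp)) (hG.differentiableAt (by simp))]
  rfl

lemma partialDeriv_partialDeriv_add (b : Module.Basis ι ℝ E) (i j : ι) {F G : E → ℂ} {u : E}
    (hF : ContDiffAt ℝ ∞ F u) (hG : ContDiffAt ℝ ∞ G u) :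
    partialDeriv b i (partialDeriv b j (F + G)) u
      = partialDeriv b i (partialDeriv b j F) u + partialDeriv b i (partialDeriv b j G) u := by
  rw [← partialDeriv_add b i (contDiffAt_partialDeriv b j hF) (contDiffAt_partialDeriv b j hG)]
  have h : partialDeriv b j (F + G) =ᶠ[nhds u] partialDeriv b j F + partialDeriv b j G := by
    have hF' := (hF.of_le (m := 1) (by simp)).eventually (by simp)
    have hG' := (hG.of_le (m := 1) (by simp)).eventually (by simp)
    filter_upwards [hF', hG'] with v h1 h2
    simp only [partialDeriv, Pi.add_apply]
    rw [fderiv_add (h1.differentiableAt (by simp)) (h2.differentiableAt (by simp))]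
    rfl
  simp only [partialDeriv] at h ⊢
  rw [h.fderiv_eq]

lemma partialDeriv_smul (b : Module.Basis ι ℝ E) (i : ι) (c : ℂ) (F : E → ℂ) :
    partialDeriv b i (c • F) = c • partialDeriv b i F := by
  funext u
  simp only [partialDeriv, Pi.smul_apply]
  rw [fderiv_const_smul_field]
  rfl

variable [Fintype ι] [DecidableEq ι]

/-- The Christoffel symbol `Γ^k_{ij}` of the Levi-Civita connection of the metric with
components `G`. -/
def christoffel (b : Module.Basis ι ℝ E) (G : E → Matrix ι ι ℝ) (k i j : ι) (u : E) : ℝ :=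
  (1 / 2) * ∑ l, (G u)⁻¹ k l *
    (partialDeriv b i (fun v => G v j l) u + partialDeriv b j (fun v => G v i l) u
      - partialDeriv b l (fun v => G v i j) u)

/-- The Ricci tensor
`R_{jk} = ∂_i Γ^i_{jk} - ∂_j Γ^i_{ik} + Γ^i_{il} Γ^l_{jk} - Γ^i_{jl} Γ^l_{ik}`. -/
def ricci (b : Module.Basis ι ℝ E) (G : E → Matrix ι ι ℝ) (j k : ι) (u : E) : ℝ :=
  ∑ i, (partialDeriv b i (christoffel b G i j k) u - partialDeriv b j (christoffel b G i i k) u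
    + ∑ l, (christoffel b G i i l u * christoffel b G l j k u
      - christoffel b G i j l u * christoffel b G l i k u))

/-- The scalar curvature `K_M(x) = g^{jk} R_{jk}`; it is `n(n-1)` on the unit sphere `S^n`. -/
def scalarCurvature (b : Module.Basis ι ℝ E) (g : MetricField I M) (x : M) : ℝ :=
  ∑ j, ∑ k, (metricMatrix I b g x (extChartAt I x x))⁻¹ j k *
    ricci b (metricMatrix I b g x) j k (extChartAt I x x)

/-- The Laplace-Beltrami operator
`Δ_M f = g^{ij} (∂_i ∂_j f - Γ^k_{ij} ∂_k f)` (trace of the Hessian). -/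
def laplaceBeltrami (b : Module.Basis ι ℝ E) (g : MetricField I M) (f : M → ℂ) (x : M) : ℂ :=
  ∑ i, ∑ j, (metricMatrix I b g x (extChartAt I x x))⁻¹ i j •
    (partialDeriv b i (partialDeriv b j (f ∘ (extChartAt I x).symm)) (extChartAt I x x)
      - ∑ k, christoffel b (metricMatrix I b g x) k i j (extChartAt I x x) •
          partialDeriv b k (f ∘ (extChartAt I x).symm) (extChartAt I x x))

/-- The Yamabe operator `Δ_M - (n-2)/(4(n-1)) K_M` of a pseudo-Riemannian manifold of dimension
`n ≥ 2`. -/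
def yamabe (b : Module.Basis ι ℝ E) (g : MetricField I M) (f : M → ℂ) (x : M) : ℂ :=
  laplaceBeltrami I b g f x
    - ((((Fintype.card ι : ℝ) - 2) / (4 * ((Fintype.card ι : ℝ) - 1))
        * scalarCurvature I b g x : ℝ) : ℂ) * f x

section Linearity

lemma contDiffAt_coord [I.Boundaryless] {f : M → ℂ} (hf : ContMDiff I 𝓘(ℝ, ℂ) ∞ f) (x : M) :
    ContDiffAt ℝ ∞ (f ∘ (extChartAt I x).symm) (extChartAt I x x) := by
  have h := ((contMDiffAt_iff (x := x)).1 (hf x)).2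
  rw [I.range_eq_univ, contDiffWithinAt_univ] at h
  exact h

lemma laplaceBeltrami_add [I.Boundaryless] (b : Module.Basis ι ℝ E) (g : MetricField I M)
    {f₁ f₂ : M → ℂ} (h₁ : ContMDiff I 𝓘(ℝ, ℂ) ∞ f₁) (h₂ : ContMDiff I 𝓘(ℝ, ℂ) ∞ f₂) (x : M) :
    laplaceBeltrami I b g (f₁ + f₂) x
      = laplaceBeltrami I b g f₁ x + laplaceBeltrami I b g f₂ x := by
  have k₁ := contDiffAt_coord I h₁ x
  have k₂ := contDiffAt_coord I h₂ x
  have e : (f₁ + f₂) ∘ (extChartAt I x).symm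
      = f₁ ∘ (extChartAt I x).symm + f₂ ∘ (extChartAt I x).symm := rfl
  simp only [laplaceBeltrami, e, partialDeriv_add b _ k₁ k₂, partialDeriv_partialDeriv_add b _ _ k₁ k₂,
    ← Finset.sum_add_distrib]
  refine Finset.sum_congr rfl fun i _ => Finset.sum_congr rfl fun j _ => ?_
  refine (congrArg _ ?_).trans (smul_add _ _ _)
  simp only [smul_add, Finset.sum_add_distrib]
  ring

lemma laplaceBeltrami_smul (b : Module.Basis ι ℝ E) (g : MetricField I M)
    (c : ℂ) (f : M → ℂ) (x : M) :
    laplaceBeltrami I b g (c • f) x = c * laplaceBeltrami I b g f x := by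
  have e : (c • f) ∘ (extChartAt I x).symm = c • (f ∘ (extChartAt I x).symm) := rfl
  simp only [laplaceBeltrami, e, partialDeriv_smul, Pi.smul_apply, smul_eq_mul, Complex.real_smul,
    Finset.mul_sum, mul_sub]
  refine Finset.sum_congr rfl fun i _ => Finset.sum_congr rfl fun j _ => ?_
  congr 1
  · ring
  · refine Finset.sum_congr rfl fun k _ => ?_
    ring

end Linearity

end PseudoRiemannian

namespace IndefiniteOrthogonal

/-- `ℝⁿ` with its Euclidean norm. -/
abbrev Euc (n : ℕ) : Type := EuclideanSpace ℝ (Fin n)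

/-- The unit sphere `S^{n-1}` in `ℝⁿ`, for `n ≥ 1`. -/
abbrev Sph (n : ℕ) : Type := Metric.sphere (0 : Euc n) 1

instance finrankFact (n : ℕ) [NeZero n] : Fact (Module.finrank ℝ (Euc n) = (n - 1) + 1) :=
  ⟨by rw [finrank_euclideanSpace_fin, Nat.sub_add_cancel (Nat.one_le_iff_ne_zero.2 (NeZero.ne n))]⟩

/-- The model of the manifold `S^{p-1} × S^{q-1}`. -/
abbrev model (p q : ℕ) := (𝓡 (p - 1)).prod (𝓡 (q - 1))

/-- The standard basis of `ℝᵐ`. -/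
abbrev stdBasis (m : ℕ) : Module.Basis (Fin m) ℝ (Euc m) := (EuclideanSpace.basisFun (Fin m) ℝ).toBasis

/-- The bilinear form of `dx_1² + ⋯ + dx_p² - dy_1² - ⋯ - dy_q²`. -/
def form {p q : ℕ} (v w : Euc p × Euc q) : ℝ := inner ℝ v.1 w.1 - inner ℝ v.2 w.2

/-- The standard Riemannian metric of the unit sphere. -/
def sphereMetric (n : ℕ) [NeZero n] : PseudoRiemannian.MetricField (𝓡 (n - 1)) (Sph n) :=
  PseudoRiemannian.inducedMetric (𝓡 (n - 1)) (fun x : Sph n => (x : Euc n))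
    (fun v w => inner ℝ v w)

/-- The pseudo-Riemannian metric that `ℝ^{p,q}` induces on `M = S^{p-1} × S^{q-1}`. -/
def productMetric (p q : ℕ) [NeZero p] [NeZero q] :
    PseudoRiemannian.MetricField (model p q) (Sph p × Sph q) :=
  PseudoRiemannian.inducedMetric (model p q)
    (fun z : Sph p × Sph q => ((z.1 : Euc p), (z.2 : Euc q))) form

/-- The Laplace-Beltrami operator of the unit sphere `S^{n-1}`. -/
def sphereLaplacian (n : ℕ) [NeZero n] (f : Sph n → ℂ) (x : Sph n) : ℂ :=
  PseudoRiemannian.laplaceBeltrami (𝓡 (n - 1)) (stdBasis (n - 1)) (sphereMetric n) f x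

/-- The operator
`(Δ_{S^{p-1}} - (p-2)²/4) - (Δ_{S^{q-1}} - (q-2)²/4)` on functions on `S^{p-1} × S^{q-1}`. -/
def yamabeOp (p q : ℕ) [NeZero p] [NeZero q] (f : Sph p × Sph q → ℂ) (z : Sph p × Sph q) : ℂ :=
  (sphereLaplacian p (fun x => f (x, z.2)) z.1 - (1 / 4) * ((p : ℂ) - 2) ^ 2 * f z)
    - (sphereLaplacian q (fun y => f (z.1, y)) z.2 - (1 / 4) * ((q : ℂ) - 2) ^ 2 * f z)

/-- The Yamabe operator of the pseudo-Riemannian manifold `S^{p-1} × S^{q-1}`, defined through its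
Laplace-Beltrami operator and its scalar curvature. -/
def intrinsicYamabe (p q : ℕ) [NeZero p] [NeZero q] (f : Sph p × Sph q → ℂ) :
    Sph p × Sph q → ℂ :=
  PseudoRiemannian.yamabe (model p q) ((stdBasis (p - 1)).prod (stdBasis (q - 1)))
    (productMetric p q) f

/-- `f` is a smooth complex-valued function on `S^{p-1} × S^{q-1}`. -/
def IsSmooth {p q : ℕ} [NeZero p] [NeZero q] (f : Sph p × Sph q → ℂ) : Prop :=
  ContMDiff (model p q) 𝓘(ℝ, ℂ) ∞ f

lemma IsSmooth.fst {p q : ℕ} [NeZero p] [NeZero q] {f : Sph p × Sph q → ℂ} (hf : IsSmooth f)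
    (y : Sph q) : ContMDiff (𝓡 (p - 1)) 𝓘(ℝ, ℂ) ∞ (fun x => f (x, y)) :=
  ContMDiff.comp (I' := model p q) hf (contMDiff_id.prodMk contMDiff_const)

lemma IsSmooth.snd {p q : ℕ} [NeZero p] [NeZero q] {f : Sph p × Sph q → ℂ} (hf : IsSmooth f)
    (x : Sph p) : ContMDiff (𝓡 (q - 1)) 𝓘(ℝ, ℂ) ∞ (fun y => f (x, y)) :=
  ContMDiff.comp (I' := model p q) hf (contMDiff_const.prodMk contMDiff_id)

/-- The space `V^{p,q}` of smooth solutions of the Yamabe equation on `S^{p-1} × S^{q-1}`. -/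
def V (p q : ℕ) [NeZero p] [NeZero q] : Submodule ℂ (Sph p × Sph q → ℂ) where
  carrier := {f | IsSmooth f ∧ ∀ z, yamabeOp p q f z = 0}
  zero_mem' := by
    refine ⟨contMDiff_const, fun z => ?_⟩
    have h (n : ℕ) [NeZero n] (x : Sph n) : sphereLaplacian n (fun _ => (0 : ℂ)) x = 0 := by
      have := PseudoRiemannian.laplaceBeltrami_smul (𝓡 (n - 1)) (stdBasis (n - 1))
        (sphereMetric n) 0 (fun _ => (0 : ℂ)) x
      rw [zero_mul, zero_smul] at this
      exact this
    simp [yamabeOp, h]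
  add_mem' := by
    rintro f g ⟨hf, hf0⟩ ⟨hg, hg0⟩
    refine ⟨ContMDiff.add hf hg, fun z => ?_⟩
    have h1 : sphereLaplacian p (fun x => (f + g) (x, z.2)) z.1
        = sphereLaplacian p (fun x => f (x, z.2)) z.1
          + sphereLaplacian p (fun x => g (x, z.2)) z.1 :=
      PseudoRiemannian.laplaceBeltrami_add _ _ _ (hf.fst z.2) (hg.fst z.2) z.1
    have h2 : sphereLaplacian q (fun y => (f + g) (z.1, y)) z.2
        = sphereLaplacian q (fun y => f (z.1, y)) z.2
          + sphereLaplacian q (fun y => g (z.1, y)) z.2 :=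
      PseudoRiemannian.laplaceBeltrami_add _ _ _ (hf.snd z.1) (hg.snd z.1) z.2
    have e1 := hf0 z
    have e2 := hg0 z
    simp only [yamabeOp] at e1 e2 ⊢
    rw [h1, h2, Pi.add_apply]
    linear_combination e1 + e2
  smul_mem' := by
    rintro c f ⟨hf, hf0⟩
    refine ⟨ContMDiff.comp (I' := 𝓘(ℝ, ℂ)) (g := fun w : ℂ => c * w)
      (ContDiff.contMDiff (contDiff_const.mul contDiff_id)) hf, fun z => ?_⟩
    have h1 : sphereLaplacian p (fun x => (c • f) (x, z.2)) z.1
        = c * sphereLaplacian p (fun x => f (x, z.2)) z.1 :=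
      PseudoRiemannian.laplaceBeltrami_smul _ _ _ c (fun x => f (x, z.2)) z.1
    have h2 : sphereLaplacian q (fun y => (c • f) (z.1, y)) z.2
        = c * sphereLaplacian q (fun y => f (z.1, y)) z.2 :=
      PseudoRiemannian.laplaceBeltrami_smul _ _ _ c (fun y => f (z.1, y)) z.2
    have e1 := hf0 z
    simp only [yamabeOp] at e1 ⊢
    rw [h1, h2, Pi.smul_apply, smul_eq_mul]
    linear_combination c * e1

/-- The matrix `I_{p,q} = diag(1, …, 1, -1, …, -1)`. -/
def Ipq (p q : ℕ) : Matrix (Fin p ⊕ Fin q) (Fin p ⊕ Fin q) ℝ :=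
  Matrix.diagonal (Sum.elim (fun _ => 1) (fun _ => -1))

/-- The indefinite orthogonal group `O(p,q)`, the matrices `g` with `ᵗg I_{p,q} g = I_{p,q}`. -/
def O (p q : ℕ) : Subgroup (GL (Fin p ⊕ Fin q) ℝ) where
  carrier := {g | (g : Matrix (Fin p ⊕ Fin q) (Fin p ⊕ Fin q) ℝ).transpose * Ipq p q
    * (g : Matrix (Fin p ⊕ Fin q) (Fin p ⊕ Fin q) ℝ) = Ipq p q}
  one_mem' := by simp
  mul_mem' := by
    intro a b ha hb
    simp only [Set.mem_ofPred_eq] at ha hb ⊢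
    rw [Units.val_mul, Matrix.transpose_mul]
    calc _ = (b : Matrix (Fin p ⊕ Fin q) (Fin p ⊕ Fin q) ℝ).transpose
          * ((a : Matrix (Fin p ⊕ Fin q) (Fin p ⊕ Fin q) ℝ).transpose * Ipq p q
            * (a : Matrix (Fin p ⊕ Fin q) (Fin p ⊕ Fin q) ℝ))
          * (b : Matrix (Fin p ⊕ Fin q) (Fin p ⊕ Fin q) ℝ) := by simp only [Matrix.mul_assoc]
      _ = _ := by rw [ha, hb]
  inv_mem' := by
    intro a ha
    simp only [Set.mem_ofPred_eq] at ha ⊢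
    have h1 : (a : Matrix (Fin p ⊕ Fin q) (Fin p ⊕ Fin q) ℝ)
        * ((a⁻¹ : GL (Fin p ⊕ Fin q) ℝ) : Matrix (Fin p ⊕ Fin q) (Fin p ⊕ Fin q) ℝ) = 1 :=
      Units.mul_inv a
    have h2 := congrArg Matrix.transpose h1
    rw [Matrix.transpose_mul, Matrix.transpose_one] at h2
    conv_lhs => rw [← ha]
    calc _ = (((a⁻¹ : GL (Fin p ⊕ Fin q) ℝ) :
            Matrix (Fin p ⊕ Fin q) (Fin p ⊕ Fin q) ℝ).transpose
            * (a : Matrix (Fin p ⊕ Fin q) (Fin p ⊕ Fin q) ℝ).transpose) * Ipq p q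
          * ((a : Matrix (Fin p ⊕ Fin q) (Fin p ⊕ Fin q) ℝ)
            * ((a⁻¹ : GL (Fin p ⊕ Fin q) ℝ) : Matrix (Fin p ⊕ Fin q) (Fin p ⊕ Fin q) ℝ)) := by
          simp only [Matrix.mul_assoc]
      _ = _ := by rw [h1, h2, Matrix.one_mul, Matrix.mul_one]

/-- The natural action of a matrix on `ℝ^{p,q}`, whose points are pairs `(x, y)`. -/
def act {p q : ℕ} (h : O p q) (z : Euc p × Euc q) : Euc p × Euc q :=
  (WithLp.toLp 2 fun i => (((h : GL (Fin p ⊕ Fin q) ℝ) :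
      Matrix (Fin p ⊕ Fin q) (Fin p ⊕ Fin q) ℝ).mulVec (Sum.elim z.1 z.2)) (Sum.inl i),
   WithLp.toLp 2 fun j => (((h : GL (Fin p ⊕ Fin q) ℝ) :
      Matrix (Fin p ⊕ Fin q) (Fin p ⊕ Fin q) ℝ).mulVec (Sum.elim z.1 z.2)) (Sum.inr j))

/-- The light cone `Ξ = {(x, y) : |x| = |y|} \ {0}`. -/
def cone (p q : ℕ) : Set (Euc p × Euc q) := {z | ‖z.1‖ = ‖z.2‖} \ {0}

/-- The function `ν(x, y) = |x| = |y|` on the light cone. -/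
def nu {p q : ℕ} (ξ : cone p q) : ℝ := ‖ξ.1.1‖

lemma nu_pos {p q : ℕ} (ξ : cone p q) : 0 < ‖ξ.1.1‖ ∧ 0 < ‖ξ.1.2‖ := by
  obtain ⟨⟨x, y⟩, h, h0⟩ := ξ
  have h' : ‖x‖ = ‖y‖ := h
  have hx : x ≠ 0 := by
    rintro rfl
    rw [norm_zero, eq_comm, norm_eq_zero] at h'
    subst h'
    exact h0 rfl
  exact ⟨norm_pos_iff.2 hx, h' ▸ norm_pos_iff.2 hx⟩

/-- The projection `Φ(x, y) = (x / |x|, y / |y|)` from the light cone to `M`, which identifies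
`Ξ / ℝ_{>0}` with `M`. -/
def Phi {p q : ℕ} (ξ : cone p q) : Sph p × Sph q :=
  (⟨‖ξ.1.1‖⁻¹ • ξ.1.1, by
      rw [mem_sphere_zero_iff_norm, norm_smul, norm_inv, norm_norm,
        inv_mul_cancel₀ (nu_pos ξ).1.ne']⟩,
   ⟨‖ξ.1.2‖⁻¹ • ξ.1.2, by
      rw [mem_sphere_zero_iff_norm, norm_smul, norm_inv, norm_norm,
        inv_mul_cancel₀ (nu_pos ξ).2.ne']⟩)

/-- The inclusion of `M = {|x| = |y| = 1}` into the light cone. -/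
def incl {p q : ℕ} (z : Sph p × Sph q) : cone p q :=
  ⟨(z.1, z.2), by
    have h1 : ‖(z.1 : Euc p)‖ = 1 := mem_sphere_zero_iff_norm.1 z.1.2
    have h2 : ‖(z.2 : Euc q)‖ = 1 := mem_sphere_zero_iff_norm.1 z.2.2
    refine ⟨h1.trans h2.symm, fun h => ?_⟩
    have h3 : (z.1 : Euc p) = 0 := congrArg Prod.fst h
    rw [h3, norm_zero] at h1
    exact zero_ne_one h1⟩

lemma dotProduct_Ipq {p q : ℕ} (z : Euc p × Euc q) :
    (Sum.elim z.1 z.2 : Fin p ⊕ Fin q → ℝ) ⬝ᵥ (Ipq p q).mulVec (Sum.elim z.1 z.2)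
      = ‖z.1‖ ^ 2 - ‖z.2‖ ^ 2 := by
  rw [EuclideanSpace.real_norm_sq_eq, EuclideanSpace.real_norm_sq_eq]
  simp [dotProduct, Ipq, Matrix.mulVec_diagonal, Fintype.sum_sum_type, sq, sub_eq_add_neg]

lemma elim_act {p q : ℕ} (h : O p q) (z : Euc p × Euc q) :
    (Sum.elim (act h z).1 (act h z).2 : Fin p ⊕ Fin q → ℝ)
      = ((h : GL (Fin p ⊕ Fin q) ℝ) :
        Matrix (Fin p ⊕ Fin q) (Fin p ⊕ Fin q) ℝ).mulVec (Sum.elim z.1 z.2) := by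
  funext k
  cases k <;> rfl

lemma act_mem_cone {p q : ℕ} (h : O p q) (ξ : cone p q) : act h ξ.1 ∈ cone p q := by
  obtain ⟨z, hz, hz0⟩ := ξ
  have hz' : ‖z.1‖ = ‖z.2‖ := hz
  have key : ‖(act h z).1‖ ^ 2 - ‖(act h z).2‖ ^ 2 = ‖z.1‖ ^ 2 - ‖z.2‖ ^ 2 := by
    rw [← dotProduct_Ipq, ← dotProduct_Ipq, elim_act, Matrix.mulVec_mulVec,
      ← Matrix.vecMul_transpose, ← Matrix.dotProduct_mulVec, Matrix.mulVec_mulVec,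
      ← Matrix.mul_assoc]
    rw [show _ = Ipq p q from h.2]
  refine ⟨?_, fun h0 => ?_⟩
  · rw [hz', sub_self, sub_eq_zero] at key
    exact (sq_eq_sq₀ (norm_nonneg _) (norm_nonneg _)).1 key
  · have h0' : act h z = 0 := h0
    have e := elim_act h z
    rw [h0'] at e
    have e' := congrArg (((h : GL (Fin p ⊕ Fin q) ℝ)⁻¹ : GL (Fin p ⊕ Fin q) ℝ) :
      Matrix (Fin p ⊕ Fin q) (Fin p ⊕ Fin q) ℝ).mulVec e
    rw [Matrix.mulVec_mulVec, Units.inv_mul, Matrix.one_mulVec] at e'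
    have e0 : (Sum.elim (0 : Euc p × Euc q).1 (0 : Euc p × Euc q).2 : Fin p ⊕ Fin q → ℝ) = 0 := by
      funext k
      cases k <;> rfl
    rw [e0, Matrix.mulVec_zero] at e'
    apply hz0
    refine Prod.ext ?_ ?_
    · ext i
      exact (congrFun e' (Sum.inl i)).symm
    · ext j
      exact (congrFun e' (Sum.inr j)).symm

/-- The action of `O(p,q)` on the light cone. -/
def actCone {p q : ℕ} (h : O p q) (ξ : cone p q) : cone p q := ⟨act h ξ.1, act_mem_cone h ξ⟩

/-- The action `L_h` of `h ∈ O(p,q)` on `M ≃ Ξ / ℝ_{>0}`. -/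
def L {p q : ℕ} (h : O p q) (z : Sph p × Sph q) : Sph p × Sph q := Phi (actCone h (incl z))

end IndefiniteOrthogonal

end

/-! Yamabe operator. In stereographic coordinates centred at a point, each sphere carries the metric
`16 / (‖u‖² + 4)²` times the flat one. This factor is `1` and stationary at the centre, so the
Christoffel symbols of the product vanish there. Hence the Laplace-Beltrami operator is the flat one
at the centre and splits (`laplaceBeltrami_product`), and the curvature comes from first derivatives
of the symbols alone (`scalarCurvature_product`): `K = (p-1)(p-2) - (q-1)(q-2) = (p-q)(p+q-3)`. As
`n - 1 = p + q - 3`, the potential is `(p-q)(p+q-4)/4 = ((p-2)² - (q-2)²)/4`.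

Representation. Extend `f` to a homogeneous function `F` of degree `λ = -(p+q-4)/2` near the cone
(`homExt`). For every homogeneous function of this degree, the ultrahyperbolic operator `box`
restricts on `M` to `yamabeOp` (`yamabeOp_restrict`): Euler's identities turn the radial terms into
the constants of the operator. The function to be studied is the restriction to `M` of `F ∘ h`,
again homogeneous of degree `λ`. Since `box` commutes with `O(p,q)` (`box_comp_act`), its `yamabeOp`
at `z` is `box F` at `h z`, a positive multiple of `L h z`; there `box F` vanishes because it does
at `L h z` (`box_smul_eq_zero`). The group law is that of composition with `h`, read on the cone
(`twist_mul`). -/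

noncomputable section

namespace IndefiniteOrthogonal

/-! ### Stereographic parametrization of the sphere and its first two derivatives. -/

section SphereChart

variable {n : ℕ} [NeZero n]

/-- The inclusion into `ℝⁿ` of the inverse of the chart of the sphere centred at `x`. -/
def sphereParam (x : Sph n) (u : Euc (n - 1)) : Euc n :=
  ((extChartAt (𝓡 (n - 1)) x).symm u : Sph n)

/-- The isometry of `ℝⁿ⁻¹` onto the orthogonal complement of `x` that the chart centred at `x`
uses. -/
def sphereFrame (x : Sph n) : Euc (n - 1) →ₗᵢ[ℝ] Euc n :=
  (Submodule.subtypeₗᵢ (Submodule.span ℝ {((-x : Sph n) : Euc n)})ᗮ).comp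
    (OrthonormalBasis.fromOrthogonalSpanSingleton (n - 1)
      (ne_zero_of_mem_unit_sphere (-x))).repr.symm.toLinearIsometry

lemma inner_sphereFrame (x : Sph n) (u : Euc (n - 1)) :
    inner ℝ (sphereFrame x u) (x : Euc n) = 0 := by
  have h : inner ℝ (sphereFrame x u) (-(x : Euc n)) = 0 :=
    Submodule.mem_orthogonal_singleton_iff_inner_left.1
      ((OrthonormalBasis.fromOrthogonalSpanSingleton (n - 1)
        (ne_zero_of_mem_unit_sphere (-x))).repr.symm u).2
  rwa [inner_neg_right, neg_eq_zero] at h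

/-- The chart centred at `x` is the stereographic projection from the antipode `-x`, so `x` itself
has coordinate `0`. -/
lemma sphereParam_eq (x : Sph n) (u : Euc (n - 1)) :
    sphereParam x u = (4 * (‖u‖ ^ 2 + 4)⁻¹) • sphereFrame x u
      + (8 * (‖u‖ ^ 2 + 4)⁻¹ - 1) • (x : Euc n) := by
  have h1 : sphereParam x u = ((stereographic' (n - 1) (-x)).symm u : Euc n) := rfl
  have h2 : ‖sphereFrame x u‖ = ‖u‖ := (sphereFrame x).norm_map u
  rw [h1, stereographic'_symm_apply]
  change (‖sphereFrame x u‖ ^ 2 + 4)⁻¹ • (4 : ℝ) • sphereFrame x u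
    + (‖sphereFrame x u‖ ^ 2 + 4)⁻¹ • (‖sphereFrame x u‖ ^ 2 - 4) • (-(x : Euc n)) = _
  rw [h2, smul_smul, smul_smul, smul_neg, ← neg_smul, mul_comm]
  congr 2
  have : ‖u‖ ^ 2 + 4 ≠ 0 := by positivity
  field_simp
  ring

lemma extChartAt_sphere_target (x : Sph n) : (extChartAt (𝓡 (n - 1)) x).target = Set.univ := by
  rw [extChartAt_target]
  change (𝓡 (n - 1)).symm ⁻¹' (stereographic' (n - 1) (-x)).target ∩ _ = _
  rw [stereographic'_target]
  simp

lemma sphereParam_zero (x : Sph n) : sphereParam x 0 = x := by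
  rw [sphereParam_eq]
  simp
  norm_num

lemma extChartAt_sphere_self (x : Sph n) : extChartAt (𝓡 (n - 1)) x x = 0 := by
  have h2 : (extChartAt (𝓡 (n - 1)) x).symm 0 = x := Subtype.ext (sphereParam_zero x)
  conv_lhs => rw [← h2]
  have h3 := (extChartAt (𝓡 (n - 1)) x).right_inv (x := 0)
    (by rw [extChartAt_sphere_target]; trivial)
  rwa [h2] at h3 ⊢

lemma hasFDerivAt_inv_norm_sq_add {m : ℕ} (u : Euc m) :
    HasFDerivAt (fun v : Euc m => (‖v‖ ^ 2 + 4)⁻¹)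
      ((-2 * ((‖u‖ ^ 2 + 4)⁻¹) ^ 2) • innerSL ℝ u) u := by
  have h0 : ‖u‖ ^ 2 + 4 ≠ 0 := by positivity
  have h1 : HasFDerivAt (fun v : Euc m => ‖v‖ ^ 2 + 4) ((2 : ℝ) • innerSL ℝ u) u := by
    have := (hasStrictFDerivAt_norm_sq u).hasFDerivAt.add_const (4 : ℝ)
    simpa [two_smul] using this
  refine ((hasDerivAt_inv h0).comp_hasFDerivAt u h1).congr_fderiv ?_
  ext w
  simp
  field_simp

/-- The derivative of `sphereParam`. -/
def sphereParamDeriv (x : Sph n) (u : Euc (n - 1)) : Euc (n - 1) →L[ℝ] Euc n :=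
  (4 * (‖u‖ ^ 2 + 4)⁻¹) • (sphereFrame x).toContinuousLinearMap
    + ((-2 * ((‖u‖ ^ 2 + 4)⁻¹) ^ 2) • innerSL ℝ u).smulRight
        ((4 : ℝ) • sphereFrame x u + (8 : ℝ) • (x : Euc n))

lemma sphereParamDeriv_apply (x : Sph n) (u w : Euc (n - 1)) :
    sphereParamDeriv x u w = (4 * (‖u‖ ^ 2 + 4)⁻¹) • sphereFrame x w
      + (-2 * ((‖u‖ ^ 2 + 4)⁻¹) ^ 2 * inner ℝ u w) •
        ((4 : ℝ) • sphereFrame x u + (8 : ℝ) • (x : Euc n)) := by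
  simp [sphereParamDeriv]

lemma hasFDerivAt_sphereParam (x : Sph n) (u : Euc (n - 1)) :
    HasFDerivAt (sphereParam x) (sphereParamDeriv x u) u := by
  have hs := hasFDerivAt_inv_norm_sq_add u
  have hU : HasFDerivAt (fun v => sphereFrame x v) (sphereFrame x).toContinuousLinearMap u :=
    (sphereFrame x).toContinuousLinearMap.hasFDerivAt
  have h := ((hs.const_mul 4).smul hU).add
    (((hs.const_mul 8).sub_const 1).smul_const (x : Euc n))
  have e : sphereParam x = fun u => (4 * (‖u‖ ^ 2 + 4)⁻¹) • sphereFrame x u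
      + (8 * (‖u‖ ^ 2 + 4)⁻¹ - 1) • (x : Euc n) := funext (sphereParam_eq x)
  rw [e]
  refine h.congr_fderiv ?_
  ext1 w
  rw [sphereParamDeriv_apply]
  simp
  module

/-- Conformality of stereographic projection. The terms in `⟪u, v⟫ ⟪u, w⟫` cancel because `4 •
sphereFrame x u + 8 • x` has squared norm `16 (‖u‖² + 4)`. -/
lemma inner_sphereParamDeriv (x : Sph n) (u v w : Euc (n - 1)) :
    inner ℝ (sphereParamDeriv x u v) (sphereParamDeriv x u w)
      = 16 * ((‖u‖ ^ 2 + 4)⁻¹) ^ 2 * inner ℝ v w := by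
  have hx : inner ℝ (x : Euc n) (x : Euc n) = (1 : ℝ) := by
    rw [real_inner_self_eq_norm_sq, mem_sphere_zero_iff_norm.1 x.2, one_pow]
  have hU (a : Euc (n - 1)) : inner ℝ (x : Euc n) (sphereFrame x a) = 0 := by
    rw [real_inner_comm, inner_sphereFrame]
  simp only [sphereParamDeriv_apply, inner_add_left, inner_add_right, inner_smul_left,
    inner_smul_right, inner_sphereFrame, hU, hx, (sphereFrame x).inner_map_map,
    real_inner_self_eq_norm_sq, real_inner_comm u v]
  simp only [conj_trivial]
  have h0 : ‖u‖ ^ 2 + 4 ≠ 0 := by positivity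
  field_simp
  ring

/-- At the centre the second derivative is purely normal: it is the second fundamental form `-⟪v, w⟫
x`, the source of the first-order radial term in the spherical Laplacian. -/
lemma hasFDerivAt_sphereParamDeriv_apply (x : Sph n) (w : Euc (n - 1)) :
    HasFDerivAt (fun u => sphereParamDeriv x u w)
      (-((innerSL ℝ w).smulRight (x : Euc n))) 0 := by
  have hs := hasFDerivAt_inv_norm_sq_add (0 : Euc (n - 1))
  have hU : HasFDerivAt (fun v => sphereFrame x v) (sphereFrame x).toContinuousLinearMap 0 :=
    (sphereFrame x).toContinuousLinearMap.hasFDerivAt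
  have hi : HasFDerivAt (fun u : Euc (n - 1) => inner ℝ u w) (innerSL ℝ w) 0 := by
    have := (innerSL ℝ w).hasFDerivAt (x := 0)
    simpa [real_inner_comm] using this
  have h := ((hs.const_mul 4).smul_const (sphereFrame x w)).add
    ((((hs.pow 2).const_mul (-2)).mul hi).smul
      ((hU.const_smul (4 : ℝ)).add_const ((8 : ℝ) • (x : Euc n))))
  simp only [sphereParamDeriv_apply]
  refine h.congr_fderiv ?_
  ext1 v
  simp
  norm_num [smul_smul]
  module

end SphereChart

end IndefiniteOrthogonal

/-! ### Induced and diagonal metrics in coordinates. -/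

namespace PseudoRiemannian

variable {ι E H M : Type*}
  [NormedAddCommGroup E] [NormedSpace ℝ E] [TopologicalSpace H] (I : ModelWithCorners ℝ E H)
  [TopologicalSpace M] [ChartedSpace H M]

lemma metricMatrix_inducedMetric [IsManifold I 1 M] [I.Boundaryless] {W : Type*}
    [NormedAddCommGroup W] [NormedSpace ℝ W]
    (b : Module.Basis ι ℝ E) {j : M → W} (hj : MDifferentiable I 𝓘(ℝ, W) j) (B : W → W → ℝ)
    (x : M) {u : E} (hu : u ∈ (extChartAt I x).target) :
    metricMatrix I b (inducedMetric I j B) x u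
      = Matrix.of fun i k => B (fderiv ℝ (j ∘ (extChartAt I x).symm) u (b i))
          (fderiv ℝ (j ∘ (extChartAt I x).symm) u (b k)) := by
  have hs : MDifferentiableAt 𝓘(ℝ, E) I (extChartAt I x).symm u :=
    ((contMDiffOn_extChartAt_symm (n := 1) x).mdifferentiableOn one_ne_zero).mdifferentiableAt
      ((isOpen_extChartAt_target x).mem_nhds hu)
  have h (w : E) : mfderiv I 𝓘(ℝ, W) j ((extChartAt I x).symm u)
      (mfderiv 𝓘(ℝ, E) I (extChartAt I x).symm u w)
        = fderiv ℝ (j ∘ (extChartAt I x).symm) u w := by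
    rw [← mfderiv_eq_fderiv, mfderiv_comp u (hj _) hs]
    rfl
  ext i k
  simp only [metricMatrix, inducedMetric, Matrix.of_apply]
  exact congrArg₂ B (h _) (h _)

variable [DecidableEq ι]

lemma partialDeriv_diagonal (b : Module.Basis ι ℝ E) (d : E → ι → ℝ) (i j k : ι) (u : E) :
    partialDeriv b i (fun v => Matrix.diagonal (d v) j k) u
      = if j = k then partialDeriv b i (fun v => d v j) u else 0 := by
  split_ifs with h
  · subst h
    simp
  · simp [Matrix.diagonal_apply_ne _ h, partialDeriv]

variable [Fintype ι]

lemma inv_diagonal_of_ne_zero {d : ι → ℝ} (hd : ∀ i, d i ≠ 0) :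
    (Matrix.diagonal d)⁻¹ = Matrix.diagonal fun i => (d i)⁻¹ := by
  refine Matrix.inv_eq_right_inv ?_
  rw [Matrix.diagonal_mul_diagonal, ← Matrix.diagonal_one]
  congr 1
  funext i
  exact mul_inv_cancel₀ (hd i)

lemma christoffel_diagonal (b : Module.Basis ι ℝ E) (d : E → ι → ℝ) {u : E}
    (hd : ∀ i, d u i ≠ 0) (k i j : ι) :
    christoffel b (fun v => Matrix.diagonal (d v)) k i j u
      = (1 / 2) * (d u k)⁻¹ * ((if j = k then partialDeriv b i (fun v => d v j) u else 0)
        + (if i = k then partialDeriv b j (fun v => d v i) u else 0)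
        - (if i = j then partialDeriv b k (fun v => d v i) u else 0)) := by
  simp only [christoffel, partialDeriv_diagonal, inv_diagonal_of_ne_zero hd]
  rw [Finset.sum_eq_single k]
  · rw [Matrix.diagonal_apply_eq, mul_assoc]
  · intro l _ hl
    rw [Matrix.diagonal_apply_ne' _ hl, zero_mul]
  · simp

/-- In a chart in which the metric is diagonal, with stationary entries at the centre, the
Laplace-Beltrami operator has no first-order terms. -/
lemma laplaceBeltrami_of_diagonal (b : Module.Basis ι ℝ E) (g : MetricField I M) (x : M)
    (d : E → ι → ℝ) (hg : metricMatrix I b g x = fun v => Matrix.diagonal (d v))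
    (hd : ∀ i, d (extChartAt I x x) i ≠ 0)
    (hd' : ∀ i j, partialDeriv b i (fun v => d v j) (extChartAt I x x) = 0) (f : M → ℂ) :
    laplaceBeltrami I b g f x = ∑ i, (d (extChartAt I x x) i)⁻¹ •
      partialDeriv b i (partialDeriv b i (f ∘ (extChartAt I x).symm)) (extChartAt I x x) := by
  simp only [laplaceBeltrami, hg, christoffel_diagonal b d hd, hd', ite_self, add_zero, sub_zero,
    mul_zero, zero_smul, Finset.sum_const_zero, inv_diagonal_of_ne_zero hd]
  refine Finset.sum_congr rfl fun i _ => ?_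
  rw [Finset.sum_eq_single i]
  · rw [Matrix.diagonal_apply_eq]
  · intro j _ hj
    rw [Matrix.diagonal_apply_ne' _ hj, zero_smul]
  · simp

end PseudoRiemannian

/-! ### The metrics of the sphere and of the product in stereographic charts. -/

namespace IndefiniteOrthogonal

open PseudoRiemannian

/-- The conformal factor of the metric of the unit sphere in stereographic coordinates. -/
def conformalFactor {m : ℕ} (u : Euc m) : ℝ := 16 * ((‖u‖ ^ 2 + 4)⁻¹) ^ 2

lemma conformalFactor_pos {m : ℕ} (u : Euc m) : 0 < conformalFactor u := by
  unfold conformalFactor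
  positivity

lemma conformalFactor_zero {m : ℕ} : conformalFactor (0 : Euc m) = 1 := by
  norm_num [conformalFactor]

lemma hasFDerivAt_conformalFactor {m : ℕ} (u : Euc m) :
    HasFDerivAt conformalFactor
      ((-4 * (‖u‖ ^ 2 + 4)⁻¹ * conformalFactor u) • innerSL ℝ u) u := by
  refine (((hasFDerivAt_inv_norm_sq_add u).pow 2).const_mul 16).congr_fderiv ?_
  ext1 w
  simp [conformalFactor]
  ring

lemma metricMatrix_sphereMetric {n : ℕ} [NeZero n] (x : Sph n) :
    metricMatrix (𝓡 (n - 1)) (stdBasis (n - 1)) (sphereMetric n) x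
      = fun u => Matrix.diagonal fun _ => conformalFactor u := by
  funext u
  have hj : MDifferentiable (𝓡 (n - 1)) 𝓘(ℝ, Euc n) (fun x : Sph n => (x : Euc n)) :=
    (contMDiff_coe_sphere (m := 1)).mdifferentiable one_ne_zero
  rw [sphereMetric, metricMatrix_inducedMetric _ _ hj _ _
    (by rw [extChartAt_sphere_target]; trivial)]
  ext i k
  rw [Matrix.of_apply,
    show (fun x : Sph n => (x : Euc n)) ∘ (extChartAt (𝓡 (n - 1)) x).symm = sphereParam x from rfl,
    (hasFDerivAt_sphereParam x u).fderiv, inner_sphereParamDeriv, Matrix.diagonal_apply]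
  simp only [OrthonormalBasis.coe_toBasis, OrthonormalBasis.inner_eq_ite, conformalFactor]
  split_ifs <;> simp

/-- The conformal factor is `1` with zero derivative at the centre, so only the flat Laplacian
survives there. -/
lemma sphereLaplacian_eq_sum {n : ℕ} [NeZero n] (f : Sph n → ℂ) (x : Sph n) :
    sphereLaplacian n f x = ∑ i, partialDeriv (stdBasis (n - 1)) i
      (partialDeriv (stdBasis (n - 1)) i (f ∘ (extChartAt (𝓡 (n - 1)) x).symm)) 0 := by
  rw [sphereLaplacian, laplaceBeltrami_of_diagonal _ _ _ x _ (metricMatrix_sphereMetric x)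
    (fun _ => (conformalFactor_pos _).ne'), extChartAt_sphere_self]
  · simp [conformalFactor_zero]
  · intro i j
    rw [extChartAt_sphere_self, partialDeriv, (hasFDerivAt_conformalFactor 0).fderiv]
    simp

section Product

variable {p q : ℕ}

/-- The coordinate basis of the model space of `S^{p-1} × S^{q-1}`. -/
abbrev prodBasis (p q : ℕ) :
    Module.Basis (Fin (p - 1) ⊕ Fin (q - 1)) ℝ (Euc (p - 1) × Euc (q - 1)) :=
  (stdBasis (p - 1)).prod (stdBasis (q - 1))

/-- The diagonal entries of the product metric in stereographic coordinates. -/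
def productDiag (u : Euc (p - 1) × Euc (q - 1)) : Fin (p - 1) ⊕ Fin (q - 1) → ℝ :=
  Sum.elim (fun _ => conformalFactor u.1) (fun _ => -conformalFactor u.2)

lemma productDiag_ne_zero (u : Euc (p - 1) × Euc (q - 1)) (i : Fin (p - 1) ⊕ Fin (q - 1)) :
    productDiag u i ≠ 0 := by
  rcases i with i | i
  · exact (conformalFactor_pos _).ne'
  · exact neg_ne_zero.2 (conformalFactor_pos _).ne'

variable [NeZero p] [NeZero q]

lemma extChartAt_product_self (z : Sph p × Sph q) : extChartAt (model p q) z z = 0 := by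
  rw [extChartAt_prod]
  exact Prod.ext (extChartAt_sphere_self z.1) (extChartAt_sphere_self z.2)

lemma coe_extChartAt_product_symm (z : Sph p × Sph q) :
    ⇑(extChartAt (model p q) z).symm
      = fun u => ((extChartAt (𝓡 (p - 1)) z.1).symm u.1, (extChartAt (𝓡 (q - 1)) z.2).symm u.2) := by
  rw [extChartAt_prod]
  rfl

lemma extChartAt_product_target (z : Sph p × Sph q) :
    (extChartAt (model p q) z).target = Set.univ := by
  rw [extChartAt_prod, PartialEquiv.prod_target, extChartAt_sphere_target,
    extChartAt_sphere_target, Set.univ_prod_univ]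

lemma contMDiff_coe_product :
    ContMDiff (model p q) 𝓘(ℝ, Euc p × Euc q) ∞
      (fun z : Sph p × Sph q => ((z.1 : Euc p), (z.2 : Euc q))) :=
  (contMDiff_coe_sphere.comp contMDiff_fst).prodMk_space (contMDiff_coe_sphere.comp contMDiff_snd)

lemma hasFDerivAt_productParam (z : Sph p × Sph q) (u : Euc (p - 1) × Euc (q - 1)) :
    HasFDerivAt ((fun z : Sph p × Sph q => ((z.1 : Euc p), (z.2 : Euc q)))
      ∘ (extChartAt (model p q) z).symm)
      ((sphereParamDeriv z.1 u.1).prodMap (sphereParamDeriv z.2 u.2)) u := by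
  rw [coe_extChartAt_product_symm]
  exact (hasFDerivAt_sphereParam z.1 u.1).prodMap u (hasFDerivAt_sphereParam z.2 u.2)

lemma form_sphereParamDeriv (z : Sph p × Sph q) (u : Euc (p - 1) × Euc (q - 1))
    (i k : Fin (p - 1) ⊕ Fin (q - 1)) :
    form ((sphereParamDeriv z.1 u.1).prodMap (sphereParamDeriv z.2 u.2) (prodBasis p q i))
      ((sphereParamDeriv z.1 u.1).prodMap (sphereParamDeriv z.2 u.2) (prodBasis p q k))
      = Matrix.diagonal (productDiag u) i k := by
  rw [Matrix.diagonal_apply]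
  rcases i with i | i <;> rcases k with k | k <;>
    simp [form, inner_sphereParamDeriv, productDiag, EuclideanSpace.inner_single_left,
      conformalFactor, eq_comm]
  split_ifs <;> simp

lemma metricMatrix_productMetric (z : Sph p × Sph q) :
    metricMatrix (model p q) (prodBasis p q) (productMetric p q) z
      = fun u => Matrix.diagonal (productDiag u) := by
  funext u
  rw [productMetric, metricMatrix_inducedMetric _ _
    (contMDiff_coe_product.mdifferentiable (by simp)) _ _
    (by rw [extChartAt_product_target]; trivial), (hasFDerivAt_productParam z u).fderiv]
  ext i k
  exact form_sphereParamDeriv z u i k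

end Product

end IndefiniteOrthogonal

/-! ### Second derivatives of compositions. -/

section SecondDerivative

variable {E W : Type*} [NormedAddCommGroup E] [NormedSpace ℝ E]
  [NormedAddCommGroup W] [NormedSpace ℝ W]

/-- The second directional derivative of a composition. -/
lemma fderiv_fderiv_comp_apply {σ : E → W} {S : E → E →L[ℝ] W} {A : E →L[ℝ] W} {F : W → ℂ}
    {u e : E} (hσ : ∀ v, HasFDerivAt σ (S v) v) (hS : HasFDerivAt (fun v => S v e) A u)
    (hF : ContDiffAt ℝ 2 F (σ u)) :
    fderiv ℝ (fun v => fderiv ℝ (F ∘ σ) v e) u e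
      = fderiv ℝ (fderiv ℝ F) (σ u) (S u e) (S u e) + fderiv ℝ F (σ u) (A e) := by
  have h1 : ∀ᶠ v in nhds u, DifferentiableAt ℝ F (σ v) :=
    (hσ u).continuousAt.eventually
      ((hF.eventually (by simp)).mono fun _ h => h.differentiableAt (by simp))
  have h2 : (fun v => fderiv ℝ (F ∘ σ) v e) =ᶠ[nhds u] fun v => fderiv ℝ F (σ v) (S v e) := by
    filter_upwards [h1] with v hv
    rw [(hv.hasFDerivAt.comp v (hσ v)).fderiv]
    rfl
  have h3 : HasFDerivAt (fderiv ℝ F) (fderiv ℝ (fderiv ℝ F) (σ u)) (σ u) :=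
    ((hF.fderiv_right (m := 1) le_rfl).differentiableAt (by simp)).hasFDerivAt
  have h4 : HasFDerivAt (fun v => fderiv ℝ F (σ v) (S v e)) _ u :=
    (h3.comp u (hσ u)).clm_apply hS
  rw [h2.fderiv_eq, h4.fderiv]
  simp [add_comm]

lemma fderiv_fderiv_apply {F : E → ℂ} {u e : E} (hF : ContDiffAt ℝ 2 F u) :
    fderiv ℝ (fun v => fderiv ℝ F v e) u e = fderiv ℝ (fderiv ℝ F) u e e := by
  have h := fderiv_fderiv_comp_apply (σ := id) (S := fun _ => ContinuousLinearMap.id ℝ E) (A := 0)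
    (u := u) (e := e) (fun v => hasFDerivAt_id v) (hasFDerivAt_const _ _) hF
  simpa using h

end SecondDerivative

namespace IndefiniteOrthogonal

open PseudoRiemannian

/-! ### Curvature and Laplacian of the product, and the intrinsic Yamabe operator. -/

section Intrinsic

variable {p q : ℕ}

/-- The logarithmic derivatives of the square root of the conformal factors. -/
def logDeriv (i : Fin (p - 1) ⊕ Fin (q - 1)) (u : Euc (p - 1) × Euc (q - 1)) : ℝ :=
  Sum.elim (fun a => -2 * (‖u.1‖ ^ 2 + 4)⁻¹ * u.1 a) (fun a => -2 * (‖u.2‖ ^ 2 + 4)⁻¹ * u.2 a) i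

lemma logDeriv_zero (i : Fin (p - 1) ⊕ Fin (q - 1)) :
    logDeriv i (0 : Euc (p - 1) × Euc (q - 1)) = 0 := by
  rcases i with i | i <;> simp [logDeriv]

lemma hasFDerivAt_logDeriv_aux {m : ℕ} (a : Fin m) :
    HasFDerivAt (fun u : Euc m => -2 * (‖u‖ ^ 2 + 4)⁻¹ * u a)
      ((-1 / 2 : ℝ) • innerSL ℝ (stdBasis m a)) 0 := by
  have h1 := (hasFDerivAt_inv_norm_sq_add (0 : Euc m)).const_mul (-2)
  have h2 : HasFDerivAt (fun u : Euc m => u a) (innerSL ℝ (stdBasis m a)) 0 := by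
    have := (innerSL ℝ (stdBasis m a)).hasFDerivAt (x := 0)
    simpa [EuclideanSpace.inner_single_left] using this
  refine (h1.mul h2).congr_fderiv ?_
  ext1 w
  simp
  norm_num

lemma partialDeriv_logDeriv (l i : Fin (p - 1) ⊕ Fin (q - 1)) :
    partialDeriv (prodBasis p q) l (logDeriv i) 0 = if l = i then -1 / 2 else 0 := by
  rcases i with i | i
  · have h : HasFDerivAt (logDeriv (Sum.inl i : Fin (p - 1) ⊕ Fin (q - 1))) _ 0 :=
      HasFDerivAt.comp (f := Prod.fst) (0 : Euc (p - 1) × Euc (q - 1)) (hasFDerivAt_logDeriv_aux i)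
        hasFDerivAt_fst
    rw [partialDeriv, h.fderiv]
    rcases l with l | l <;> simp [EuclideanSpace.inner_single_left, eq_comm]
  · have h : HasFDerivAt (logDeriv (Sum.inr i : Fin (p - 1) ⊕ Fin (q - 1))) _ 0 :=
      HasFDerivAt.comp (f := Prod.snd) (0 : Euc (p - 1) × Euc (q - 1)) (hasFDerivAt_logDeriv_aux i)
        hasFDerivAt_snd
    rw [partialDeriv, h.fderiv]
    rcases l with l | l <;> simp [EuclideanSpace.inner_single_left, eq_comm]

lemma differentiableAt_logDeriv (i : Fin (p - 1) ⊕ Fin (q - 1)) :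
    DifferentiableAt ℝ (logDeriv i) (0 : Euc (p - 1) × Euc (q - 1)) := by
  rcases i with i | i
  · exact (HasFDerivAt.comp (f := Prod.fst) (0 : Euc (p - 1) × Euc (q - 1))
      (hasFDerivAt_logDeriv_aux i) hasFDerivAt_fst).differentiableAt
  · exact (HasFDerivAt.comp (f := Prod.snd) (0 : Euc (p - 1) × Euc (q - 1))
      (hasFDerivAt_logDeriv_aux i) hasFDerivAt_snd).differentiableAt

/-- Each diagonal entry depends only on the coordinates of its own sphere, which is what comparing
`isLeft` records. The `2` appears because `logDeriv` refers to the square root of the conformal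
factor. -/
lemma partialDeriv_productDiag (u : Euc (p - 1) × Euc (q - 1))
    (i j : Fin (p - 1) ⊕ Fin (q - 1)) :
    partialDeriv (prodBasis p q) i (fun v => productDiag v j) u
      = if i.isLeft = j.isLeft then 2 * logDeriv i u * productDiag u j else 0 := by
  rcases j with j | j
  · have h : HasFDerivAt (fun v : Euc (p - 1) × Euc (q - 1) =>
        productDiag v (Sum.inl j : Fin (p - 1) ⊕ Fin (q - 1))) _ u :=
      (hasFDerivAt_conformalFactor u.1).comp u hasFDerivAt_fst
    rw [partialDeriv, h.fderiv]
    rcases i with i | i <;> simp [EuclideanSpace.inner_single_right, logDeriv, productDiag]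
    ring
  · have h : HasFDerivAt (fun v : Euc (p - 1) × Euc (q - 1) =>
        productDiag v (Sum.inr j : Fin (p - 1) ⊕ Fin (q - 1))) _ u :=
      ((hasFDerivAt_conformalFactor u.2).comp u hasFDerivAt_snd).neg
    rw [partialDeriv, h.fderiv]
    rcases i with i | i <;> simp [EuclideanSpace.inner_single_right, logDeriv, productDiag]
    ring

lemma productDiag_congr (u : Euc (p - 1) × Euc (q - 1)) {i j : Fin (p - 1) ⊕ Fin (q - 1)}
    (h : i.isLeft = j.isLeft) : productDiag u i = productDiag u j := by
  rcases i with i | i <;> rcases j with j | j <;> simp_all [productDiag]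

/-- Within each sphere this is the conformally flat formula `δ_jk φ_i + δ_ik φ_j - δ_ij φ_k`, with
`φ` the gradient of the logarithm of the root of the conformal factor. The sign of the second block
cancels between the metric and its inverse. -/
lemma christoffel_product (k i j : Fin (p - 1) ⊕ Fin (q - 1)) :
    christoffel (prodBasis p q) (fun v => Matrix.diagonal (productDiag v)) k i j
      = fun u => (if j = k ∧ i.isLeft = j.isLeft then logDeriv i u else 0)
        + (if i = k ∧ j.isLeft = i.isLeft then logDeriv j u else 0)
        - (if i = j ∧ k.isLeft = i.isLeft then logDeriv k u else 0) := by
  funext u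
  have h := productDiag_ne_zero u k
  -- The condition `hab` puts `b` and `k` in the same block, so the two diagonal entries cancel.
  have key (a b : Fin (p - 1) ⊕ Fin (q - 1)) (P : Prop) [Decidable P]
      (hab : P → a.isLeft = b.isLeft → b.isLeft = k.isLeft) :
      (1 / 2) * (productDiag u k)⁻¹ * (if P then
        partialDeriv (prodBasis p q) a (fun v => productDiag v b) u else 0)
        = if P ∧ a.isLeft = b.isLeft then logDeriv a u else 0 := by
    rw [partialDeriv_productDiag, ← ite_and]
    split_ifs with hP
    · rw [productDiag_congr u (hab hP.1 hP.2)]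
      field_simp
    · ring
  rw [christoffel_diagonal _ _ (productDiag_ne_zero u), mul_sub, mul_add, key, key, key]
  · rintro - h2
    exact h2.symm
  · rintro rfl -
    rfl
  · rintro rfl -
    rfl

lemma partialDeriv_christoffel_product (l k i j : Fin (p - 1) ⊕ Fin (q - 1)) :
    partialDeriv (prodBasis p q) l
        (christoffel (prodBasis p q) (fun v => Matrix.diagonal (productDiag v)) k i j) 0
      = (if j = k ∧ i.isLeft = j.isLeft then if l = i then -1 / 2 else 0 else 0)
        + (if i = k ∧ j.isLeft = i.isLeft then if l = j then -1 / 2 else 0 else 0)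
        - (if i = j ∧ k.isLeft = i.isLeft then if l = k then -1 / 2 else 0 else 0) := by
  have key (a : Fin (p - 1) ⊕ Fin (q - 1)) (P : Prop) [Decidable P] :
      HasFDerivAt (fun u : Euc (p - 1) × Euc (q - 1) => if P then logDeriv a u else 0)
        (if P then fderiv ℝ (logDeriv a) (0 : Euc (p - 1) × Euc (q - 1)) else 0) 0 := by
    split_ifs
    · exact (differentiableAt_logDeriv a).hasFDerivAt
    · exact hasFDerivAt_const _ _
  have app (a : Fin (p - 1) ⊕ Fin (q - 1)) (P : Prop) [Decidable P] :
      (if P then fderiv ℝ (logDeriv a) (0 : Euc (p - 1) × Euc (q - 1)) else 0) (prodBasis p q l)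
        = if P then if l = a then -1 / 2 else 0 else 0 := by
    by_cases hP : P
    · simp only [if_pos hP]
      exact partialDeriv_logDeriv l a
    · simp [hP]
  rw [christoffel_product, partialDeriv, (((key i (j = k ∧ i.isLeft = j.isLeft)).fun_add
    (key j (i = k ∧ j.isLeft = i.isLeft))).fun_sub (key k (i = j ∧ k.isLeft = i.isLeft))).fderiv]
  simp only [sub_apply, add_apply, app]

/-- The quadratic terms vanish at the centre. An index `i ≠ j` of the same sphere contributes `1/2 +
1/2`, its sectional curvature; a mixed pair contributes `0`. Diagonal components suffice since the
inverse metric is diagonal. -/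
lemma ricci_product (j : Fin (p - 1) ⊕ Fin (q - 1)) :
    ricci (prodBasis p q) (fun v => Matrix.diagonal (productDiag v)) j j 0
      = ∑ i, ((if i.isLeft = j.isLeft then 1 else 0) - if i = j then 1 else 0) := by
  rw [ricci]
  refine Finset.sum_congr rfl fun i _ => ?_
  have h0 (k i j : Fin (p - 1) ⊕ Fin (q - 1)) : christoffel (prodBasis p q)
      (fun v => Matrix.diagonal (productDiag v)) k i j 0 = 0 := by
    simp [christoffel_product, logDeriv_zero]
  simp only [h0, partialDeriv_christoffel_product, mul_zero, sub_zero, Finset.sum_const_zero,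
    add_zero]
  by_cases h1 : i = j
  · subst h1
    norm_num
  · have h1' : j ≠ i := fun h => h1 h.symm
    by_cases h2 : i.isLeft = j.isLeft
    · norm_num [h1, h1', h2]
    · have h2' : j.isLeft ≠ i.isLeft := fun h => h2 h.symm
      norm_num [h1, h1', h2, h2']

variable [NeZero p] [NeZero q]

lemma scalarCurvature_product (z : Sph p × Sph q) :
    scalarCurvature (model p q) (prodBasis p q) (productMetric p q) z
      = ((p : ℝ) - 1) * (p - 2) - (q - 1) * (q - 2) := by
  simp only [scalarCurvature, metricMatrix_productMetric, extChartAt_product_self,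
    inv_diagonal_of_ne_zero (productDiag_ne_zero 0)]
  have h (j : Fin (p - 1) ⊕ Fin (q - 1)) :
      ∑ k, Matrix.diagonal (fun i => (productDiag (0 : Euc (p - 1) × Euc (q - 1)) i)⁻¹) j k
        * ricci (prodBasis p q) (fun v => Matrix.diagonal (productDiag v)) j k 0
      = (productDiag (0 : Euc (p - 1) × Euc (q - 1)) j)⁻¹
        * ∑ i : Fin (p - 1) ⊕ Fin (q - 1),
          ((if i.isLeft = j.isLeft then 1 else 0) - if i = j then 1 else 0) := by
    rw [Finset.sum_eq_single j, Matrix.diagonal_apply_eq, ricci_product]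
    · intro k _ hk
      rw [Matrix.diagonal_apply_ne' _ hk, zero_mul]
    · simp
  have hp : ((p - 1 : ℕ) : ℝ) = p - 1 := Nat.cast_pred (NeZero.pos p)
  have hq : ((q - 1 : ℕ) : ℝ) = q - 1 := Nat.cast_pred (NeZero.pos q)
  rw [Finset.sum_congr rfl fun j _ => h j]
  simp only [Finset.sum_sub_distrib, Finset.sum_ite_eq', Finset.mem_univ, if_true,
    Fintype.sum_sum_type, productDiag, Sum.elim_inl, Sum.elim_inr, Sum.isLeft_inl, Sum.isLeft_inr,
    Prod.fst_zero, Prod.snd_zero, conformalFactor_zero]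
  simp [hp, hq]
  ring

lemma laplaceBeltrami_product {f : Sph p × Sph q → ℂ} (hf : IsSmooth f) (z : Sph p × Sph q) :
    laplaceBeltrami (model p q) (prodBasis p q) (productMetric p q) f z
      = sphereLaplacian p (fun x => f (x, z.2)) z.1 - sphereLaplacian q (fun y => f (z.1, y)) z.2 := by
  have hs : ContDiffAt ℝ 2 (f ∘ (extChartAt (model p q) z).symm) 0 := by
    have h := contDiffAt_coord (model p q) hf z
    rw [extChartAt_product_self] at h
    exact contDiffAt_infty.1 h 2
  rw [laplaceBeltrami_of_diagonal _ _ _ z _ (metricMatrix_productMetric z)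
    (fun _ => productDiag_ne_zero _ _), extChartAt_product_self, sphereLaplacian_eq_sum,
    sphereLaplacian_eq_sum, Fintype.sum_sum_type, sub_eq_add_neg, ← Finset.sum_neg_distrib]
  · have e0 {n : ℕ} [NeZero n] (x : Sph n) : (extChartAt (𝓡 (n - 1)) x).symm 0 = x :=
      Subtype.ext (sphereParam_zero x)
    congr 1
    · refine Finset.sum_congr rfl fun i _ => ?_
      -- Freezing `z.2` amounts to restricting the product chart to the slice where the second
      -- coordinate is `0`.
      have h1 : (fun x => f (x, z.2)) ∘ (extChartAt (𝓡 (p - 1)) z.1).symm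
          = (f ∘ (extChartAt (model p q) z).symm) ∘ fun u => (u, (0 : Euc (q - 1))) := by
        rw [coe_extChartAt_product_symm]
        funext u
        exact congrArg (fun y => f (_, y)) (e0 z.2).symm
      rw [h1]
      refine Eq.trans ?_ (fderiv_fderiv_comp_apply (A := 0)
        (σ := fun u => (u, (0 : Euc (q - 1)))) (fun v => hasFDerivAt_prodMk_left v _)
        (hasFDerivAt_const _ _) hs).symm
      refine (congrArg _ (fderiv_fderiv_apply hs)).trans ?_
      simp [productDiag, conformalFactor_zero]
      rfl
    · refine Finset.sum_congr rfl fun i _ => ?_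
      have h1 : (fun y => f (z.1, y)) ∘ (extChartAt (𝓡 (q - 1)) z.2).symm
          = (f ∘ (extChartAt (model p q) z).symm) ∘ fun u => ((0 : Euc (p - 1)), u) := by
        rw [coe_extChartAt_product_symm]
        funext u
        exact congrArg (fun x => f (x, _)) (e0 z.1).symm
      rw [h1]
      refine Eq.trans ?_ (congrArg Neg.neg (fderiv_fderiv_comp_apply (A := 0)
        (σ := fun u => ((0 : Euc (p - 1)), u)) (fun v => hasFDerivAt_prodMk_right _ v) (hasFDerivAt_const _ _) hs).symm)
      refine (congrArg _ (fderiv_fderiv_apply hs)).trans ?_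
      simp [productDiag, conformalFactor_zero]
      rfl
  · intro i j
    rw [extChartAt_product_self, partialDeriv_productDiag, logDeriv_zero]
    simp

theorem intrinsicYamabe_eq (hpq : 4 ≤ p + q) {f : Sph p × Sph q → ℂ} (hf : IsSmooth f) :
    intrinsicYamabe p q f = yamabeOp p q f := by
  funext z
  rw [intrinsicYamabe, yamabe, laplaceBeltrami_product hf, scalarCurvature_product, yamabeOp,
    Fintype.card_sum, Fintype.card_fin, Fintype.card_fin]
  have hp : ((p - 1 : ℕ) : ℝ) = p - 1 := Nat.cast_pred (NeZero.pos p)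
  have hq : ((q - 1 : ℕ) : ℝ) = q - 1 := Nat.cast_pred (NeZero.pos q)
  have hn : (p : ℝ) + q - 3 ≠ 0 := by
    have : (4 : ℝ) ≤ p + q := by exact_mod_cast hpq
    linarith
  -- The curvature factors as `(p-q)(p+q-3)`, and `p+q-3` is the `n - 1` of the denominator.
  have e : (((p - 1 + (q - 1) : ℕ) : ℝ) - 2) / (4 * (((p - 1 + (q - 1) : ℕ) : ℝ) - 1))
      * (((p : ℝ) - 1) * (p - 2) - (q - 1) * (q - 2))
      = (1 / 4) * ((p : ℝ) - 2) ^ 2 - (1 / 4) * ((q : ℝ) - 2) ^ 2 := by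
    rw [Nat.cast_add, hp, hq]
    have hn' : (p : ℝ) - 1 + (q - 1) - 1 ≠ 0 := by
      convert hn using 1
      ring
    field_simp
    ring
  rw [e]
  push_cast
  ring

end Intrinsic

end IndefiniteOrthogonal

/-! ### Traces of bilinear forms and Euler's identities. -/

section TraceAndEuler

variable {E : Type*} [NormedAddCommGroup E]

/-- The trace of a bilinear form does not depend on the orthonormal basis. -/
lemma sum_bilin_orthonormalBasis [InnerProductSpace ℝ E] [FiniteDimensional ℝ E] {ι κ : Type*}
    [Fintype ι] [Fintype κ] (v : OrthonormalBasis ι ℝ E) (w : OrthonormalBasis κ ℝ E)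
    (B : E →L[ℝ] E →L[ℝ] ℂ) : ∑ i, B (v i) (v i) = ∑ j, B (w j) (w j) := by
  have h := congrArg (TensorProduct.lift (B.toLinearMap₁₂))
    ((InnerProductSpace.canonicalCovariantTensor_eq_sum E v).symm.trans
      (InnerProductSpace.canonicalCovariantTensor_eq_sum E w))
  simpa using h

variable [NormedSpace ℝ E] {F : E → ℂ} {lam : ℝ}

lemma fderiv_self_of_homogeneous
    (hom : ∀ t : ℝ, 0 < t → ∀ ξ, F (t • ξ) = ((t ^ lam : ℝ) : ℂ) * F ξ) {ξ : E}
    (hF : DifferentiableAt ℝ F ξ) : fderiv ℝ F ξ ξ = lam * F ξ := by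
  have h1 : HasDerivAt (fun t : ℝ => F (t • ξ)) (fderiv ℝ F ξ ξ) 1 := by
    have hs : HasDerivAt (fun t : ℝ => t • ξ) ξ 1 := by
      simpa using (hasDerivAt_id (1 : ℝ)).smul_const ξ
    have hF' : HasFDerivAt F (fderiv ℝ F ξ) ((1 : ℝ) • ξ) := by
      rw [one_smul]
      exact hF.hasFDerivAt
    exact hF'.comp_hasDerivAt (1 : ℝ) hs
  have h2 : HasDerivAt (fun t : ℝ => ((t ^ lam : ℝ) : ℂ) * F ξ) (lam * F ξ) 1 := by
    have := ((Real.hasDerivAt_rpow_const (x := 1) (p := lam)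
      (Or.inl one_ne_zero)).ofReal_comp).mul_const (F ξ)
    simpa using this
  refine h1.unique (h2.congr_of_eventuallyEq ?_)
  filter_upwards [lt_mem_nhds (zero_lt_one' ℝ)] with t ht
  exact hom t ht ξ

/-- Differentiate Euler's identity in the direction `v`: the argument `η` of `fderiv ℝ F η η`
contributes an extra `fderiv ℝ F ξ v`, which lowers the degree by one. -/
lemma fderiv_fderiv_self_of_homogeneous
    (hom : ∀ t : ℝ, 0 < t → ∀ ξ, F (t • ξ) = ((t ^ lam : ℝ) : ℂ) * F ξ) {ξ : E}
    (hF : ContDiffAt ℝ 2 F ξ) (v : E) :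
    fderiv ℝ (fderiv ℝ F) ξ v ξ = (lam - 1) * fderiv ℝ F ξ v := by
  have h1 : HasFDerivAt (fun η => fderiv ℝ F η η) _ ξ :=
    ((hF.fderiv_right (m := 1) le_rfl).differentiableAt (by simp)).hasFDerivAt.clm_apply
      (hasFDerivAt_id ξ)
  have h2 : HasFDerivAt (fun η => (lam : ℂ) * F η) _ ξ :=
    (hF.differentiableAt (by simp)).hasFDerivAt.const_mul (lam : ℂ)
  have h3 : (fun η => fderiv ℝ F η η) =ᶠ[nhds ξ] fun η => (lam : ℂ) * F η := by
    filter_upwards [hF.eventually (by simp)] with η hη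
    exact fderiv_self_of_homogeneous hom (hη.differentiableAt (by simp))
  have h4 := DFunLike.congr_fun (h1.unique (h2.congr_of_eventuallyEq h3)) v
  simp at h4
  linear_combination h4

end TraceAndEuler

namespace IndefiniteOrthogonal

open PseudoRiemannian

/-! ### The spherical Laplacian through ambient derivatives. -/

section SphereTrace

variable {n : ℕ} [NeZero n]

/-- The tangent frame together with the normal `x` is an orthonormal basis of `ℝⁿ`, and the trace
does not depend on such a basis. -/
lemma sum_sphereFrame (x : Sph n) (B : Euc n →L[ℝ] Euc n →L[ℝ] ℂ) :
    ∑ i, B (sphereFrame x (stdBasis (n - 1) i)) (sphereFrame x (stdBasis (n - 1) i)) + B x x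
      = ∑ i, B (stdBasis n i) (stdBasis n i) := by
  let w : Fin (n - 1) ⊕ Unit → Euc n :=
    Sum.elim (fun i => sphereFrame x (stdBasis (n - 1) i)) (fun _ => x)
  have hx : inner ℝ (x : Euc n) (x : Euc n) = (1 : ℝ) := by
    rw [real_inner_self_eq_norm_sq, mem_sphere_zero_iff_norm.1 x.2, one_pow]
  have hw : Orthonormal ℝ w := by
    rw [orthonormal_iff_ite]
    rintro (i | i) (j | j)
    · have h := orthonormal_iff_ite.1 (EuclideanSpace.basisFun (Fin (n - 1)) ℝ).orthonormal i j
      simp only [w, Sum.elim_inl, (sphereFrame x).inner_map_map, Sum.inl.injEq]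
      exact h
    · simp only [w, Sum.elim_inl, Sum.elim_inr, inner_sphereFrame, reduceCtorEq, if_false]
    · simp only [w, Sum.elim_inl, Sum.elim_inr, reduceCtorEq, if_false]
      rw [real_inner_comm, inner_sphereFrame]
    · simp only [w, Sum.elim_inr, hx, if_true]
  have hcard : Fintype.card (Fin (n - 1) ⊕ Unit) = Module.finrank ℝ (Euc n) := by
    rw [(finrankFact n).out]
    simp
  have h := sum_bilin_orthonormalBasis (OrthonormalBasis.mk hw
    (hw.linearIndependent.span_eq_top_of_card_eq_finrank' hcard).ge)
    (EuclideanSpace.basisFun (Fin n) ℝ) B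
  simpa [w] using h

/-- The Laplacian on the sphere of the restriction of a function on the ambient space. -/
lemma sphereLaplacian_comp_affine {W : Type*} [NormedAddCommGroup W] [NormedSpace ℝ W]
    (T : Euc n →L[ℝ] W) (c : W) {F : W → ℂ} (x : Sph n) (hF : ContDiffAt ℝ 2 F (T x + c)) :
    sphereLaplacian n (fun y => F (T y + c)) x
      = ∑ i, fderiv ℝ (fderiv ℝ F) (T x + c) (T (stdBasis n i)) (T (stdBasis n i))
        - fderiv ℝ (fderiv ℝ F) (T x + c) (T x) (T x) - (n - 1) * fderiv ℝ F (T x + c) (T x) := by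
  have hσ (u : Euc (n - 1)) :
      HasFDerivAt (fun u => T (sphereParam x u) + c) (T.comp (sphereParamDeriv x u)) u :=
    (T.hasFDerivAt.comp u (hasFDerivAt_sphereParam x u)).add_const c
  have hS (e : Euc (n - 1)) : HasFDerivAt (fun u => T.comp (sphereParamDeriv x u) e)
      (T.comp (-((innerSL ℝ e).smulRight (x : Euc n)))) 0 :=
    T.hasFDerivAt.comp (0 : Euc (n - 1)) (hasFDerivAt_sphereParamDeriv_apply x e)
  have h0 (e : Euc (n - 1)) : sphereParamDeriv x 0 e = sphereFrame x e := by
    rw [sphereParamDeriv_apply]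
    simp
  have hF' : ContDiffAt ℝ 2 F (T (sphereParam x 0) + c) := by rwa [sphereParam_zero]
  have key (i : Fin (n - 1)) : partialDeriv (stdBasis (n - 1)) i
      (partialDeriv (stdBasis (n - 1)) i
        ((fun y : Sph n => F (T y + c)) ∘ (extChartAt (𝓡 (n - 1)) x).symm)) 0
      = fderiv ℝ (fderiv ℝ F) (T x + c) (T (sphereFrame x (stdBasis (n - 1) i)))
          (T (sphereFrame x (stdBasis (n - 1) i))) - fderiv ℝ F (T x + c) (T x) := by
    have h := fderiv_fderiv_comp_apply hσ (hS (stdBasis (n - 1) i)) hF'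
    rw [sphereParam_zero] at h
    refine h.trans ?_
    rw [ContinuousLinearMap.comp_apply, ContinuousLinearMap.comp_apply, h0]
    simp [sub_eq_add_neg]
  -- The bilinear form here is the second derivative of `F` pulled back along `T` in both arguments.
  have htr := sum_sphereFrame x ((ContinuousLinearMap.compL ℝ (Euc n) W ℂ).flip T ∘L
    (fderiv ℝ (fderiv ℝ F) (T x + c)) ∘L T)
  simp only [ContinuousLinearMap.comp_apply, ContinuousLinearMap.flip_apply,
    ContinuousLinearMap.compL_apply] at htr
  have hn : ((n - 1 : ℕ) : ℂ) = n - 1 := Nat.cast_pred (NeZero.pos n)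
  rw [sphereLaplacian_eq_sum, Finset.sum_congr rfl fun i _ => key i, Finset.sum_sub_distrib,
    ← htr, Finset.sum_const, Finset.card_univ, Fintype.card_fin, nsmul_eq_mul, hn]
  ring

end SphereTrace

/-! ### The ultrahyperbolic operator restricted to `M`. -/

section Box

variable {p q : ℕ}

/-- The ultrahyperbolic operator of `ℝ^{p,q}`. -/
def box (F : Euc p × Euc q → ℂ) (ξ : Euc p × Euc q) : ℂ :=
  ∑ i, fderiv ℝ (fderiv ℝ F) ξ (stdBasis p i, 0) (stdBasis p i, 0)
    - ∑ j, fderiv ℝ (fderiv ℝ F) ξ (0, stdBasis q j) (0, stdBasis q j)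

/-- The degree of homogeneity for which `box` is conformally invariant along the cone. -/
def weight (p q : ℕ) : ℝ := -(((p : ℝ) + (q : ℝ) - 4) / 2)

/-- On homogeneous functions of degree `weight p q` the ultrahyperbolic operator restricts to
`yamabeOp`. -/
lemma yamabeOp_restrict [NeZero p] [NeZero q] {F : Euc p × Euc q → ℂ}
    (hom : ∀ t : ℝ, 0 < t → ∀ ξ, F (t • ξ) = ((t ^ weight p q : ℝ) : ℂ) * F ξ)
    (z : Sph p × Sph q) (hF : ContDiffAt ℝ 2 F (z.1, z.2)) :
    yamabeOp p q (fun z => F (z.1, z.2)) z = box F (z.1, z.2) := by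
  have e1 : ((z.1 : Euc p), (0 : Euc q)) + ((0 : Euc p), (z.2 : Euc q)) = ((z.1 : Euc p), (z.2 : Euc q)) := by simp
  have e2 : ((0 : Euc p), (z.2 : Euc q)) + ((z.1 : Euc p), (0 : Euc q))
      = ((z.1 : Euc p), (z.2 : Euc q)) := by simp
  have h1 := sphereLaplacian_comp_affine (ContinuousLinearMap.inl ℝ (Euc p) (Euc q))
    ((0 : Euc p), (z.2 : Euc q)) (F := F) z.1 (by simpa using hF)
  have h2 := sphereLaplacian_comp_affine (ContinuousLinearMap.inr ℝ (Euc p) (Euc q))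
    ((z.1 : Euc p), (0 : Euc q)) (F := F) z.2 (by simpa using hF)
  simp only [ContinuousLinearMap.inl_apply, ContinuousLinearMap.inr_apply, e1, e2] at h1 h2
  simp only [Prod.mk_add_mk, add_zero, zero_add] at h1 h2
  have eu := fderiv_self_of_homogeneous hom (hF.differentiableAt (by simp))
  have ex := fderiv_fderiv_self_of_homogeneous hom hF ((z.1 : Euc p), (0 : Euc q))
  have ey := fderiv_fderiv_self_of_homogeneous hom hF ((0 : Euc p), (z.2 : Euc q))
  have sy := (hF.isSymmSndFDerivAt (by simp)).eq ((z.1 : Euc p), (0 : Euc q))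
    ((0 : Euc p), (z.2 : Euc q))
  have split (A : (Euc p × Euc q) →L[ℝ] ℂ) :
      A (z.1, z.2) = A ((z.1 : Euc p), (0 : Euc q)) + A ((0 : Euc p), (z.2 : Euc q)) := by
    rw [← map_add, e1]
  rw [split] at eu ex ey
  have hw : (weight p q : ℂ) = -(((p : ℂ) + q - 4) / 2) := by
    simp [weight]
  rw [hw] at eu ex ey
  simp only [yamabeOp, box]
  rw [h1, h2]
  -- Write `a = (x, 0)`, `b = (0, y)`. Subtracting the second-order Euler identities, the mixed
  -- terms cancel by symmetry and `D²F(a,a) - D²F(b,b) = (λ-1)(DF a - DF b)`. As `λ + p - 2 =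
  -- (p-q)/2 = -(λ + q - 2)`, what remains is a multiple of `DF a + DF b = λ F`.
  linear_combination -ex + ey + sy - (((p : ℂ) - q) / 2) * eu

end Box

end IndefiniteOrthogonal

namespace IndefiniteOrthogonal

/-! ### Invariance of the ultrahyperbolic operator under `O(p,q)` and dilations. -/

section Action

variable {p q : ℕ}

/-- The action of an element of `O(p,q)` on `ℝ^{p,q}` as a continuous linear map. -/
def actCLM (h : O p q) : Euc p × Euc q →L[ℝ] Euc p × Euc q :=
  LinearMap.toContinuousLinearMap
    { toFun := act h
      map_add' := by
        intro z w
        have e : (Sum.elim (z + w).1 (z + w).2 : Fin p ⊕ Fin q → ℝ)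
            = Sum.elim z.1 z.2 + Sum.elim w.1 w.2 := by
          funext k
          cases k <;> rfl
        refine Prod.ext ?_ ?_ <;> ext i <;>
          simp only [act, e, Matrix.mulVec_add] <;> rfl
      map_smul' := by
        intro c z
        have e : (Sum.elim (c • z).1 (c • z).2 : Fin p ⊕ Fin q → ℝ) = c • Sum.elim z.1 z.2 := by
          funext k
          cases k <;> rfl
        refine Prod.ext ?_ ?_ <;> ext i <;>
          simp only [act, e, Matrix.mulVec_smul] <;> rfl }

lemma actCLM_apply (h : O p q) (z : Euc p × Euc q) : actCLM h z = act h z := rfl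

lemma elim_injective {z w : Euc p × Euc q}
    (h : (Sum.elim z.1 z.2 : Fin p ⊕ Fin q → ℝ) = Sum.elim w.1 w.2) : z = w := by
  refine Prod.ext ?_ ?_
  · ext i
    exact congrFun h (Sum.inl i)
  · ext j
    exact congrFun h (Sum.inr j)

lemma act_one (z : Euc p × Euc q) : act 1 z = z := by
  refine elim_injective ?_
  rw [elim_act]
  simp

lemma act_mul (h k : O p q) (z : Euc p × Euc q) : act (h * k) z = act h (act k z) := by
  refine elim_injective ?_
  rw [elim_act, elim_act, elim_act, Matrix.mulVec_mulVec]
  simp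

lemma act_smul (h : O p q) (t : ℝ) (z : Euc p × Euc q) : act h (t • z) = t • act h z :=
  (actCLM h).map_smul t z

lemma Ipq_mul_Ipq : Ipq p q * Ipq p q = 1 := by
  rw [Ipq, Matrix.diagonal_mul_diagonal, ← Matrix.diagonal_one]
  congr 1
  funext k
  cases k <;> simp

/-- `Ipq * hᵗ * Ipq` is a left inverse of `h`, hence a right inverse. This form of the relation is
needed because the trace sums over the columns of `h`. -/
lemma mul_Ipq_mul_transpose (h : O p q) :
    ((h : GL (Fin p ⊕ Fin q) ℝ) : Matrix (Fin p ⊕ Fin q) (Fin p ⊕ Fin q) ℝ) * Ipq p q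
      * ((h : GL (Fin p ⊕ Fin q) ℝ) : Matrix (Fin p ⊕ Fin q) (Fin p ⊕ Fin q) ℝ).transpose
      = Ipq p q := by
  obtain ⟨h, hh⟩ := h
  have h1 : (h : Matrix (Fin p ⊕ Fin q) (Fin p ⊕ Fin q) ℝ).transpose * Ipq p q
      * (h : Matrix (Fin p ⊕ Fin q) (Fin p ⊕ Fin q) ℝ) = Ipq p q := hh
  have h2 : (Ipq p q * (h : Matrix (Fin p ⊕ Fin q) (Fin p ⊕ Fin q) ℝ).transpose * Ipq p q)
      * (h : Matrix (Fin p ⊕ Fin q) (Fin p ⊕ Fin q) ℝ) = 1 := by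
    rw [Matrix.mul_assoc, Matrix.mul_assoc, ← Matrix.mul_assoc _ (Ipq p q), h1, Ipq_mul_Ipq]
  have h3 := congrArg (· * Ipq p q) (mul_eq_one_comm.1 h2)
  simp only [Matrix.mul_assoc, Ipq_mul_Ipq, Matrix.mul_one, Matrix.one_mul] at h3
  rw [Matrix.mul_assoc]
  exact h3

/-- The standard basis of `ℝ^{p,q}`. -/
abbrev ambientBasis (p q : ℕ) : Module.Basis (Fin p ⊕ Fin q) ℝ (Euc p × Euc q) :=
  (stdBasis p).prod (stdBasis q)

lemma eq_sum_ambientBasis (z : Euc p × Euc q) :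
    z = ∑ k, (Sum.elim z.1 z.2 : Fin p ⊕ Fin q → ℝ) k • ambientBasis p q k := by
  conv_lhs => rw [← (ambientBasis p q).sum_repr z]
  refine Finset.sum_congr rfl fun k _ => ?_
  cases k <;> simp

lemma act_ambientBasis (h : O p q) (k : Fin p ⊕ Fin q) :
    actCLM h (ambientBasis p q k) = ∑ i, ((h : GL (Fin p ⊕ Fin q) ℝ) :
      Matrix (Fin p ⊕ Fin q) (Fin p ⊕ Fin q) ℝ) i k • ambientBasis p q i := by
  rw [actCLM_apply, eq_sum_ambientBasis (act h _), elim_act]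
  have e : (Sum.elim (ambientBasis p q k).1 (ambientBasis p q k).2 : Fin p ⊕ Fin q → ℝ)
      = Pi.single k 1 := by
    funext l
    cases k <;> cases l <;> simp [Pi.single_apply]
  rw [e]
  simp

/-- The trace of a bilinear form with respect to the metric of `ℝ^{p,q}` is invariant under
`O(p,q)`. -/
lemma sum_bilin_act (h : O p q) (B : Euc p × Euc q →L[ℝ] Euc p × Euc q →L[ℝ] ℂ) :
    ∑ k, (Sum.elim (fun _ => 1) (fun _ => -1) k : ℝ) •
        B (actCLM h (ambientBasis p q k)) (actCLM h (ambientBasis p q k))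
      = ∑ k, (Sum.elim (fun _ => 1) (fun _ => -1) k : ℝ) •
        B (ambientBasis p q k) (ambientBasis p q k) := by
  set m := ((h : GL (Fin p ⊕ Fin q) ℝ) : Matrix (Fin p ⊕ Fin q) (Fin p ⊕ Fin q) ℝ) with hm
  set c : Fin p ⊕ Fin q → ℝ := Sum.elim (fun _ => 1) (fun _ => -1) with hc
  have hm' (i j : Fin p ⊕ Fin q) : ∑ k, c k * (m i k * m j k) = Matrix.diagonal c i j := by
    have := congrFun (congrFun (mul_Ipq_mul_transpose h) i) j
    rw [Matrix.mul_apply] at this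
    simp only [Ipq, Matrix.mul_diagonal, Matrix.transpose_apply] at this
    rw [← this]
    refine Finset.sum_congr rfl fun k _ => ?_
    ring
  calc _ = ∑ k, ∑ i, ∑ j, (c k * (m i k * m j k)) • B (ambientBasis p q i) (ambientBasis p q j) := by
        refine Finset.sum_congr rfl fun k _ => ?_
        simp only [act_ambientBasis, map_sum, map_smul, sum_apply, smul_apply,
          Finset.smul_sum, smul_smul]
        rw [Finset.sum_comm]
        refine Finset.sum_congr rfl fun i _ => Finset.sum_congr rfl fun j _ => ?_
        congr 1
        ring
    _ = ∑ i, ∑ j, Matrix.diagonal c i j • B (ambientBasis p q i) (ambientBasis p q j) := by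
        rw [Finset.sum_comm]
        refine Finset.sum_congr rfl fun i _ => ?_
        rw [Finset.sum_comm]
        refine Finset.sum_congr rfl fun j _ => ?_
        rw [← Finset.sum_smul, hm']
    _ = _ := by
        refine Finset.sum_congr rfl fun i _ => ?_
        rw [Finset.sum_eq_single i]
        · rw [Matrix.diagonal_apply_eq]
        · intro j _ hj
          rw [Matrix.diagonal_apply_ne' _ hj, zero_smul]
        · simp

lemma box_eq_sum (F : Euc p × Euc q → ℂ) (ξ : Euc p × Euc q) :
    box F ξ = ∑ k, (Sum.elim (fun _ => 1) (fun _ => -1) k : ℝ) •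
      fderiv ℝ (fderiv ℝ F) ξ (ambientBasis p q k) (ambientBasis p q k) := by
  simp [box, sub_eq_add_neg]

lemma box_comp_eq_sum (T : Euc p × Euc q →L[ℝ] Euc p × Euc q) {F : Euc p × Euc q → ℂ}
    {ξ : Euc p × Euc q} (hF : ContDiffAt ℝ 2 F (T ξ)) :
    box (F ∘ T) ξ = ∑ k, (Sum.elim (fun _ => 1) (fun _ => -1) k : ℝ) •
      fderiv ℝ (fderiv ℝ F) (T ξ) (T (ambientBasis p q k)) (T (ambientBasis p q k)) := by
  rw [box_eq_sum]
  refine Finset.sum_congr rfl fun k _ => ?_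
  congr 1
  have h := fderiv_fderiv_comp_apply (A := 0) (e := ambientBasis p q k)
    (fun v => T.hasFDerivAt (x := v)) (hasFDerivAt_const _ ξ) hF
  rw [fderiv_fderiv_apply (hF.comp ξ T.contDiff.contDiffAt)] at h
  simpa using h

lemma box_comp_act (h : O p q) {F : Euc p × Euc q → ℂ} {ξ : Euc p × Euc q}
    (hF : ContDiffAt ℝ 2 F (act h ξ)) : box (F ∘ act h) ξ = box F (act h ξ) := by
  have e := box_comp_eq_sum (actCLM h) hF
  rw [sum_bilin_act, ← box_eq_sum] at e
  exact e

/-- `box F` is homogeneous of degree `lam - 2`: the chain rule for the dilation by `t` produces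
`t²`, homogeneity of `F` produces `t ^ lam`. -/
lemma box_smul_eq_zero {F : Euc p × Euc q → ℂ} {lam : ℝ}
    (hom : ∀ t : ℝ, 0 < t → ∀ ξ, F (t • ξ) = ((t ^ lam : ℝ) : ℂ) * F ξ) {t : ℝ} (ht : 0 < t)
    {ξ : Euc p × Euc q} (hF : ContDiffAt ℝ 2 F (t • ξ)) (h0 : box F ξ = 0) :
    box F (t • ξ) = 0 := by
  have h1 := box_comp_eq_sum (t • ContinuousLinearMap.id ℝ (Euc p × Euc q)) (ξ := ξ) hF
  have h2 : F ∘ (t • ContinuousLinearMap.id ℝ (Euc p × Euc q)) = (t ^ lam) • F :=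
    funext fun η => (hom t ht η).trans Complex.real_smul.symm
  have h3 : box ((t ^ lam) • F) ξ = (t ^ lam) • box F ξ := by
    have e : fderiv ℝ (fderiv ℝ ((t ^ lam) • F)) ξ = (t ^ lam) • fderiv ℝ (fderiv ℝ F) ξ := by
      rw [fderiv_const_smul_field]
      exact congrFun (fderiv_const_smul_field (𝕜 := ℝ) (f := fderiv ℝ F) (t ^ lam)) ξ
    simp only [box, e, smul_apply, ← Finset.smul_sum, smul_sub]
  have h4 : box F (t • ξ) * (t : ℂ) ^ 2 = 0 := by
    rw [h2, h3, h0, smul_zero] at h1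
    rw [box_eq_sum, Finset.sum_mul, h1]
    refine Finset.sum_congr rfl fun k _ => ?_
    simp
    ring
  exact (mul_eq_zero.1 h4).resolve_right (pow_ne_zero 2 (by exact_mod_cast ht.ne'))

end Action

/-! ### Homogeneous extension from `M`. -/

section Extension

variable {p q : ℕ}

/-- Radial projection of a nonzero vector to the unit sphere. -/
def direction {n : ℕ} (x : Euc n) (hx : x ≠ 0) : Sph n :=
  ⟨‖x‖⁻¹ • x, by
    rw [mem_sphere_zero_iff_norm, norm_smul, norm_inv, norm_norm,
      inv_mul_cancel₀ (norm_ne_zero_iff.2 hx)]⟩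

open Classical in
/-- The homogeneous extension, of degree `lam`, of a function on `S^{p-1} × S^{q-1}`. -/
def homExt (lam : ℝ) (f : Sph p × Sph q → ℂ) (ξ : Euc p × Euc q) : ℂ :=
  if h : ξ.1 ≠ 0 ∧ ξ.2 ≠ 0 then
    ((‖ξ.1‖ ^ lam : ℝ) : ℂ) * f (direction ξ.1 h.1, direction ξ.2 h.2)
  else 0

/-- The default value `0` makes homogeneity hold at every `ξ`, as the Euler identities require. -/
lemma homExt_smul (lam : ℝ) (f : Sph p × Sph q → ℂ) (t : ℝ) (ht : 0 < t) (ξ : Euc p × Euc q) :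
    homExt lam f (t • ξ) = ((t ^ lam : ℝ) : ℂ) * homExt lam f ξ := by
  have hd {n : ℕ} (x : Euc n) (hx : x ≠ 0) (hx' : t • x ≠ 0) :
      direction (t • x) hx' = direction x hx := by
    refine Subtype.ext ?_
    simp only [direction]
    rw [norm_smul, Real.norm_of_nonneg ht.le, smul_smul, mul_inv, mul_right_comm,
      inv_mul_cancel₀ ht.ne', one_mul]
  by_cases h : ξ.1 ≠ 0 ∧ ξ.2 ≠ 0
  · have h' : (t • ξ).1 ≠ 0 ∧ (t • ξ).2 ≠ 0 :=
      ⟨smul_ne_zero ht.ne' h.1, smul_ne_zero ht.ne' h.2⟩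
    rw [homExt, homExt, dif_pos h, dif_pos h']
    simp only [Prod.smul_fst, Prod.smul_snd, hd _ h.1, hd _ h.2, norm_smul,
      Real.norm_of_nonneg ht.le, Real.mul_rpow ht.le (norm_nonneg _)]
    push_cast
    ring
  · have h' : ¬((t • ξ).1 ≠ 0 ∧ (t • ξ).2 ≠ 0) := by
      simpa [ht.ne'] using h
    rw [homExt, homExt, dif_neg h, dif_neg h', mul_zero]

lemma homExt_cone (lam : ℝ) (f : Sph p × Sph q → ℂ) (ξ : cone p q) :
    homExt lam f ξ.1 = ((nu ξ ^ lam : ℝ) : ℂ) * f (Phi ξ) :=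
  dif_pos ⟨norm_pos_iff.1 (nu_pos ξ).1, norm_pos_iff.1 (nu_pos ξ).2⟩

lemma coe_eq_nu_smul_incl_Phi (ξ : cone p q) : ξ.1 = nu ξ • (incl (Phi ξ)).1 := by
  have h1 := (nu_pos ξ).1.ne'
  have h2 := (nu_pos ξ).2.ne'
  have h3 : ‖ξ.1.1‖ = ‖ξ.1.2‖ := ξ.2.1
  refine Prod.ext ?_ ?_
  · change ξ.1.1 = ‖ξ.1.1‖ • ‖ξ.1.1‖⁻¹ • ξ.1.1
    rw [smul_smul, mul_inv_cancel₀ h1, one_smul]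
  · change ξ.1.2 = ‖ξ.1.1‖ • ‖ξ.1.2‖⁻¹ • ξ.1.2
    rw [h3, smul_smul, mul_inv_cancel₀ h2, one_smul]

lemma homExt_incl (lam : ℝ) (f : Sph p × Sph q → ℂ) (z : Sph p × Sph q) :
    homExt lam f (z.1, z.2) = f z := by
  have h1 : ‖(z.1 : Euc p)‖ = 1 := mem_sphere_zero_iff_norm.1 z.1.2
  have h2 : ‖(z.2 : Euc q)‖ = 1 := mem_sphere_zero_iff_norm.1 z.2.2
  have hn : nu (incl z) = 1 := h1
  have hP : Phi (incl z) = z := by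
    refine Prod.ext (Subtype.ext ?_) (Subtype.ext ?_)
    · change ‖(z.1 : Euc p)‖⁻¹ • (z.1 : Euc p) = z.1
      rw [h1, inv_one, one_smul]
    · change ‖(z.2 : Euc q)‖⁻¹ • (z.2 : Euc q) = z.2
      rw [h2, inv_one, one_smul]
  have h := homExt_cone lam f (incl z)
  rw [hn, hP, Real.one_rpow, Complex.ofReal_one, one_mul] at h
  exact h

variable [NeZero p] [NeZero q]

lemma contDiffAt_homExt (lam : ℝ) {f : Sph p × Sph q → ℂ} (hf : IsSmooth f) {ξ : Euc p × Euc q}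
    (h1 : ξ.1 ≠ 0) (h2 : ξ.2 ≠ 0) : ContDiffAt ℝ ∞ (homExt lam f) ξ := by
  let U : TopologicalSpace.Opens (Euc p × Euc q) := ⟨{η | η.1 ≠ 0 ∧ η.2 ≠ 0},
    (isOpen_ne.preimage continuous_fst).inter (isOpen_ne.preimage continuous_snd)⟩
  have hd1 : ContMDiff 𝓘(ℝ, Euc p × Euc q) (𝓡 (p - 1)) ∞
      (fun η : U => direction η.1.1 η.2.1) := by
    refine ContMDiff.codRestrict_sphere (f := fun η : U => ‖η.1.1‖⁻¹ • η.1.1) (fun η => ?_) _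
    refine contMDiffAt_subtype_iff (f := fun η : Euc p × Euc q => ‖η.1‖⁻¹ • η.1).2 ?_
    exact (((contDiffAt_fst.norm ℝ η.2.1).inv (norm_ne_zero_iff.2 η.2.1)).smul
      contDiffAt_fst).contMDiffAt
  have hd2 : ContMDiff 𝓘(ℝ, Euc p × Euc q) (𝓡 (q - 1)) ∞
      (fun η : U => direction η.1.2 η.2.2) := by
    refine ContMDiff.codRestrict_sphere (f := fun η : U => ‖η.1.2‖⁻¹ • η.1.2) (fun η => ?_) _
    refine contMDiffAt_subtype_iff (f := fun η : Euc p × Euc q => ‖η.2‖⁻¹ • η.2).2 ?_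
    exact (((contDiffAt_snd.norm ℝ η.2.2).inv (norm_ne_zero_iff.2 η.2.2)).smul
      contDiffAt_snd).contMDiffAt
  have hfd : ContMDiff 𝓘(ℝ, Euc p × Euc q) 𝓘(ℝ, ℂ) ∞
      (fun η : U => f (direction η.1.1 η.2.1, direction η.1.2 η.2.2)) :=
    ContMDiff.comp (I' := model p q) hf (hd1.prodMk hd2)
  -- In degree `0` the extension is `f` composed with the radial projections, smooth on `U`; the
  -- power of the norm is a separate smooth factor.
  let G : Euc p × Euc q → ℂ := homExt 0 f
  have hG : ContDiffAt ℝ ∞ G ξ := by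
    refine ContMDiffAt.contDiffAt ?_
    refine (contMDiffAt_subtype_iff (U := U) (f := G) (x := ⟨ξ, h1, h2⟩)).1 ?_
    have e : (fun η : U => G η)
        = fun η : U => f (direction η.1.1 η.2.1, direction η.1.2 η.2.2) := by
      funext η
      have : η.1.1 ≠ 0 ∧ η.1.2 ≠ 0 := η.2
      simp [G, homExt, this]
    rw [e]
    exact hfd _
  have hn : ContDiffAt ℝ ∞ (fun η : Euc p × Euc q => ((‖η.1‖ ^ lam : ℝ) : ℂ)) ξ :=
    Complex.ofRealCLM.contDiff.contDiffAt.comp ξ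
      ((contDiffAt_fst.norm ℝ h1).rpow_const_of_ne (norm_ne_zero_iff.2 h1))
  refine (hn.mul hG).congr_of_eventuallyEq (Filter.Eventually.of_forall fun η => ?_)
  by_cases h : η.1 ≠ 0 ∧ η.2 ≠ 0
  · simp [G, homExt, h]
  · simp only [G, homExt, dif_neg h, mul_zero]

end Extension

/-! ### The twisted action and the representation. -/

section Twist

variable {p q : ℕ}

/-- The conformally twisted pullback of a function on `S^{p-1} × S^{q-1}` by an element of
`O(p,q)`. -/
def twist (h : O p q) (f : Sph p × Sph q → ℂ) (z : Sph p × Sph q) : ℂ :=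
  ((nu (actCone h (incl z)) ^ weight p q : ℝ) : ℂ) * f (L h z)

lemma twist_eq_homExt (h : O p q) (f : Sph p × Sph q → ℂ) (z : Sph p × Sph q) :
    twist h f z = (homExt (weight p q) f ∘ act h) (z.1, z.2) :=
  (homExt_cone (weight p q) f (actCone h (incl z))).symm

/-- Off the cone the two extensions need not agree. Agreement on the cone suffices for the group
law, since `O(p,q)` preserves the cone. -/
lemma homExt_twist (h : O p q) (f : Sph p × Sph q → ℂ) (ξ : cone p q) :
    homExt (weight p q) (twist h f) ξ.1 = homExt (weight p q) f (act h ξ.1) := by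
  rw [homExt_cone, twist_eq_homExt, Function.comp_apply, ← homExt_smul _ _ (nu ξ) (nu_pos ξ).1,
    ← act_smul]
  exact congrArg (fun η => homExt (weight p q) f (act h η)) (coe_eq_nu_smul_incl_Phi ξ).symm

lemma twist_one (f : Sph p × Sph q → ℂ) : twist 1 f = f := by
  funext z
  rw [twist_eq_homExt, Function.comp_apply, act_one, homExt_incl]

lemma twist_mul (h k : O p q) (f : Sph p × Sph q → ℂ) :
    twist (h * k) f = twist k (twist h f) := by
  funext z
  rw [twist_eq_homExt, twist_eq_homExt, Function.comp_apply, Function.comp_apply, act_mul]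
  exact (homExt_twist h f (actCone k (incl z))).symm

variable [NeZero p] [NeZero q]

lemma contDiffAt_homExt_act (h : O p q) {f : Sph p × Sph q → ℂ} (hf : IsSmooth f)
    (z : Sph p × Sph q) : ContDiffAt ℝ ∞ (homExt (weight p q) f) (act h (z.1, z.2)) :=
  contDiffAt_homExt _ hf (norm_pos_iff.1 (nu_pos (actCone h (incl z))).1)
    (norm_pos_iff.1 (nu_pos (actCone h (incl z))).2)

lemma isSmooth_twist (h : O p q) {f : Sph p × Sph q → ℂ} (hf : IsSmooth f) :
    IsSmooth (twist h f) := by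
  have e : twist h f = (homExt (weight p q) f ∘ actCLM h)
      ∘ fun z : Sph p × Sph q => ((z.1 : Euc p), (z.2 : Euc q)) := funext (twist_eq_homExt h f)
  rw [e]
  intro z
  exact ((contDiffAt_homExt_act h hf z).comp ((z.1 : Euc p), (z.2 : Euc q))
    (actCLM h).contDiff.contDiffAt).contMDiffAt.comp z (contMDiff_coe_product z)

lemma twist_mem_V (h : O p q) {f : Sph p × Sph q → ℂ} (hf : f ∈ V p q) : twist h f ∈ V p q := by
  obtain ⟨hs, h0⟩ := hf
  refine ⟨isSmooth_twist h hs, fun z => ?_⟩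
  have hC : ContDiffAt ℝ 2 (homExt (weight p q) f) (act h (z.1, z.2)) :=
    contDiffAt_infty.1 (contDiffAt_homExt_act h hs z) 2
  have hom := homExt_smul (weight p q) f
  have e : twist h f = fun z => (homExt (weight p q) f ∘ act h) (z.1, z.2) :=
    funext (twist_eq_homExt h f)
  -- The restriction formula is applied to `F ∘ h` directly: it needs homogeneity only, not the
  -- particular extension `homExt`.
  rw [e, yamabeOp_restrict _ z (hC.comp _ (actCLM h).contDiff.contDiffAt), box_comp_act h hC]
  · have hξ := coe_eq_nu_smul_incl_Phi (actCone h (incl z))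
    change act h (z.1, z.2) = _ at hξ
    rw [hξ] at hC ⊢
    refine box_smul_eq_zero hom (nu_pos (actCone h (incl z))).1 hC ?_
    -- Taking the identity of the group gives smoothness at the point `L h z` itself.
    have hC1 := contDiffAt_homExt_act 1 hs (L h z)
    rw [act_one] at hC1
    have h2 := yamabeOp_restrict hom (L h z) (contDiffAt_infty.1 hC1 2)
    rw [show (fun z : Sph p × Sph q => homExt (weight p q) f (z.1, z.2)) = f from
      funext (homExt_incl _ f), h0] at h2
    exact h2.symm
  · intro t ht ξ
    rw [Function.comp_apply, Function.comp_apply, act_smul, hom t ht]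

/-- The representation `ϖ^{p,q}` of `O(p,q)` on `V^{p,q}`. -/
def varpi (p q : ℕ) [NeZero p] [NeZero q] : Representation ℂ (O p q) (V p q) where
  toFun g :=
    { toFun := fun f => ⟨twist g⁻¹ f, twist_mem_V g⁻¹ f.2⟩
      map_add' := fun f₁ f₂ => Subtype.ext (funext fun z => mul_add _ _ _)
      map_smul' := fun c f => Subtype.ext (funext fun z => mul_left_comm _ _ _) }
  map_one' := by
    refine LinearMap.ext fun f => Subtype.ext ?_
    change twist 1⁻¹ (f : Sph p × Sph q → ℂ) = f
    rw [inv_one, twist_one]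
  map_mul' g₁ g₂ := by
    refine LinearMap.ext fun f => Subtype.ext ?_
    change twist (g₁ * g₂)⁻¹ (f : Sph p × Sph q → ℂ) = twist g₁⁻¹ (twist g₂⁻¹ f)
    rw [mul_inv_rev, twist_mul]

end Twist

end IndefiniteOrthogonal

end

theorem theorem3p4p2 (p q : ℕ) [NeZero p] [NeZero q] :
    (∃ ρ : Representation ℂ (IndefiniteOrthogonal.O p q) (IndefiniteOrthogonal.V p q),
      ∀ (h : IndefiniteOrthogonal.O p q) (f : IndefiniteOrthogonal.V p q)
        (z : IndefiniteOrthogonal.Sph p × IndefiniteOrthogonal.Sph q),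
        (ρ h⁻¹ f : IndefiniteOrthogonal.Sph p × IndefiniteOrthogonal.Sph q → ℂ) z
          = ((IndefiniteOrthogonal.nu
                (IndefiniteOrthogonal.actCone h (IndefiniteOrthogonal.incl z))
              ^ (-(((p : ℝ) + (q : ℝ) - 4) / 2)) : ℝ) : ℂ)
            * (f : IndefiniteOrthogonal.Sph p × IndefiniteOrthogonal.Sph q → ℂ)
                (IndefiniteOrthogonal.L h z)) ∧
    (4 ≤ p + q →
      ∀ f : IndefiniteOrthogonal.Sph p × IndefiniteOrthogonal.Sph q → ℂ,
        IndefiniteOrthogonal.IsSmooth f →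
          IndefiniteOrthogonal.intrinsicYamabe p q f = IndefiniteOrthogonal.yamabeOp p q f) := by
  refine ⟨⟨IndefiniteOrthogonal.varpi p q, fun h f z => ?_⟩,
    fun hpq f hf => IndefiniteOrthogonal.intrinsicYamabe_eq hpq hf⟩
  change IndefiniteOrthogonal.twist h⁻¹⁻¹
    (f : IndefiniteOrthogonal.Sph p × IndefiniteOrthogonal.Sph q → ℂ) z = _
  rw [inv_inv]
  rfl
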